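/- **Corollary (Huge coefficients).** For $n\ge 1$ let $\rho_n$ be the maximal determinant of an $n\times n$ matrix with entries in $\{0,1\}$, and let $\chi(n)$ be the maximal absolute value of an entry of $A^{-1}$, over all invertible $n\times n$ matrices $A$ with entries in $\{0,1\}$. A $0/1$-polytope in $\mathbb{R}^d$ is the convex hull of a set of points of $\{0,1\}^d$. For $d\ge 2$ let $\operatorname{coeff}(d)$ be the largest absolute value $|c_i|$, $1\le i\le d$, of a coefficient in an inequality $$c_0+c_1x_1+\dots+c_dx_d\ \ge\ 0,\qquad c_0,\dots,c_d\in\mathbb{Z},\quad \gcd(c_1,\dots,c_d)=1,$$ that defines a facet of a full-dimensional $0/1$-polytope $P\subseteq\mathbb{R}^d$ (that is, the inequality holds on $P$, and the points of $P$ where equality holds form a face of dimension $d-1$). For every $d\ge 2$ these maxima, $\chi(d-1)$, $\operatorname{coeff}(d)$ and $\rho_{d-1}$, exist, and there is a function $\varepsilon:\mathbb{N}\to\mathbb{R}$ with $\varepsilon(d)=o(d)$ as $d\to\infty$ such that for all $d\ge 2$ $$\frac{(d-1)^{(d-1)/2}}{2^{2d+\varepsilon(d)}}\ \le\ \chi(d-1)\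 \le\ \operatorname{coeff}(d)\ \le\ \rho_{d-1}\ \le\ \frac{d^{d/2}}{2^{d-1}}.$$ -/

import Mathlib

open Filter Asymptotics

noncomputable section

namespace ZeroOnePolytope

/-- A square matrix all of whose entries are `0` or `1`. -/
def IsZeroOneMatrix {n : ℕ} (A : Matrix (Fin n) (Fin n) ℝ) : Prop :=
  ∀ i j, A i j = 0 ∨ A i j = 1

/-- The determinants of the `n × n` matrices with entries in `{0, 1}`. -/
def detSet (n : ℕ) : Set ℝ :=
  {t | ∃ A : Matrix (Fin n) (Fin n) ℝ, IsZeroOneMatrix A ∧ t = A.det}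

/-- `ρ_n`, the maximal determinant of an `n × n` matrix with entries in `{0, 1}`. -/
def rho (n : ℕ) : ℝ := sSup (detSet n)

/-- The absolute values of the entries of the inverses of the invertible `n × n` matrices with
entries in `{0, 1}`. -/
def invEntrySet (n : ℕ) : Set ℝ :=
  {t | ∃ A : Matrix (Fin n) (Fin n) ℝ, IsZeroOneMatrix A ∧ A.det ≠ 0 ∧
    ∃ i j, t = |A⁻¹ i j|}

/-- `χ(n)`, the maximal absolute value of an entry in the inverse of an invertible `n × n` matrix
with entries in `{0, 1}` (meaningful for `n ≥ 1`). -/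
def chi (n : ℕ) : ℝ := sSup (invEntrySet n)

/-- A `0/1`-polytope in `ℝ^d`: the convex hull of a (necessarily finite) set of points with all
coordinates in `{0, 1}`. -/
def IsZeroOnePolytope {d : ℕ} (P : Set (Fin d → ℝ)) : Prop :=
  ∃ V : Set (Fin d → ℝ), (∀ v ∈ V, ∀ i, v i = 0 ∨ v i = 1) ∧ P = convexHull ℝ V

/-- The dimension of the affine hull of a (nonempty) set of points. -/
def affineDim {d : ℕ} (S : Set (Fin d → ℝ)) : ℕ := Module.finrank ℝ (vectorSpan ℝ S)

/-- A set in `ℝ^d` of dimension `d`. -/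
def IsFullDimensional {d : ℕ} (P : Set (Fin d → ℝ)) : Prop :=
  P.Nonempty ∧ affineDim P = d

/-- The face of `P` cut out by the hyperplane `c₀ + c₁ x₁ + ⋯ + c_d x_d = 0`. -/
def face {d : ℕ} (c₀ : ℤ) (c : Fin d → ℤ) (P : Set (Fin d → ℝ)) : Set (Fin d → ℝ) :=
  {x ∈ P | (c₀ : ℝ) + ∑ i, (c i : ℝ) * x i = 0}

/-- The inequality `c₀ + c₁ x₁ + ⋯ + c_d x_d ≥ 0` is valid on `P`, and the points of `P` where it
holds with equality form a facet, that is, a (nonempty) face of dimension `d - 1`. -/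
def DefinesFacet {d : ℕ} (c₀ : ℤ) (c : Fin d → ℤ) (P : Set (Fin d → ℝ)) : Prop :=
  (∀ x ∈ P, 0 ≤ (c₀ : ℝ) + ∑ i, (c i : ℝ) * x i) ∧
    (face c₀ c P).Nonempty ∧ affineDim (face c₀ c P) + 1 = d

/-- The absolute values `|c_i|`, `1 ≤ i ≤ d`, of the coefficients of the reduced integral
inequalities `c₀ + c₁ x₁ + ⋯ + c_d x_d ≥ 0` that define a facet of a full-dimensional
`0/1`-polytope in `ℝ^d`. Reduced means `gcd(c₁, …, c_d) = 1`. -/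
def coeffSet (d : ℕ) : Set ℕ :=
  {k | ∃ (P : Set (Fin d → ℝ)) (c₀ : ℤ) (c : Fin d → ℤ),
    IsZeroOnePolytope P ∧ IsFullDimensional P ∧ Finset.univ.gcd c = 1 ∧ DefinesFacet c₀ c P ∧
    ∃ i, k = (c i).natAbs}

/-- `coeff(d)`, the largest coefficient in a reduced integral facet inequality of a
full-dimensional `0/1`-polytope in `ℝ^d`. -/
def coeff (d : ℕ) : ℕ := sSup (coeffSet d)

end ZeroOnePolytope

end

namespace ZeroOnePolytope

/-! ### The maxima exist -/

/-! Put n = d - 1. The upper bounds are determinantal. Differences of vertices of a facet contain n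
linearly independent vectors, and reflecting coordinates turns these into 0/1 vectors. By Cramer's
rule each coordinate of a primitive integer normal divides an n × n minor of them, so it is at most
ρ_n (`natCast_le_rho_of_mem_coeffSet`). Bordering a 0/1 matrix of order n gives a ±1 matrix of order
n + 1 whose determinant is 2^n times as large in absolute value, and Hadamard's inequality bounds
that (`rho_le`).

For χ(n) ≤ coeff(d), append the column e_j to an invertible 0/1 matrix A. The new rows are
orthogonal to (-A⁻¹e_j, 1). The primitive integer multiple of this vector is a facet normal with
nonzero last coordinate, so its other coordinates are at least as large as the inverse entries
(`exists_mem_coeffSet_abs_inv_le`).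

The lower bound on χ is the Alon–Vu construction. For n near 2^m, start from the characters of the
Boolean cube and replace the rows of all but the first set with at least 3 elements, in binary
order, by averages of characters that are still ±1-valued. In character coordinates a system with
this matrix becomes a recursion along the list: each new coordinate is at least 2^(|a|-1) - 2 times
the previous one (`prod_mul_le_of_isChain_linked`). The product of these factors has binary
logarithm about m2^m/2 - 2^m, which forces a huge inverse entry (`prod_le_two_pow_mul_chi`). For
general n, blocks given by the binary digits of n are combined using χ(a)χ(b) ≤ χ(a + b); convexity
of t log t controls the loss, which gives the constant 2 in 2^(2d + ε(d)) (`le_logb_chi`). -/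

theorem finite_zeroOneMatrix (n : ℕ) :
    {A : Matrix (Fin n) (Fin n) ℝ | IsZeroOneMatrix A}.Finite := by
  have h : {A : Matrix (Fin n) (Fin n) ℝ | IsZeroOneMatrix A} =
      Set.univ.pi fun _ => Set.univ.pi fun _ => ({0, 1} : Set ℝ) := by
    ext A
    exact ⟨fun h i _ j _ => h i j, fun h i j => h i trivial j trivial⟩
  rw [h]
  exact Set.Finite.pi fun _ => Set.Finite.pi fun _ => Set.toFinite _

theorem finite_detSet (n : ℕ) : (detSet n).Finite := by
  refine ((finite_zeroOneMatrix n).image Matrix.det).subset ?_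
  rintro t ⟨A, hA, rfl⟩
  exact ⟨A, hA, rfl⟩

theorem isZeroOneMatrix_one (n : ℕ) : IsZeroOneMatrix (1 : Matrix (Fin n) (Fin n) ℝ) := by
  intro i j
  by_cases h : i = j <;> simp [Matrix.one_apply, h]

theorem isGreatest_rho (n : ℕ) : IsGreatest (detSet n) (rho n) :=
  ⟨Set.Nonempty.csSup_mem ⟨_, 1, isZeroOneMatrix_one n, rfl⟩ (finite_detSet n),
    fun _ h => le_csSup (finite_detSet n).bddAbove h⟩

theorem finite_invEntrySet (n : ℕ) : (invEntrySet n).Finite := by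
  refine Set.Finite.subset (((finite_zeroOneMatrix n).prod
    (Set.finite_univ (α := Fin n × Fin n))).image fun p => |p.1⁻¹ p.2.1 p.2.2|) ?_
  rintro t ⟨A, hA, -, i, j, rfl⟩
  exact ⟨(A, i, j), ⟨hA, trivial⟩, rfl⟩

theorem one_mem_invEntrySet {n : ℕ} (hn : 0 < n) : (1 : ℝ) ∈ invEntrySet n :=
  ⟨1, isZeroOneMatrix_one n, by simp, ⟨0, hn⟩, ⟨0, hn⟩, by simp⟩

theorem isGreatest_chi {n : ℕ} (hn : 0 < n) : IsGreatest (invEntrySet n) (chi n) :=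
  ⟨Set.Nonempty.csSup_mem ⟨1, one_mem_invEntrySet hn⟩ (finite_invEntrySet n),
    fun _ h => le_csSup (finite_invEntrySet n).bddAbove h⟩

theorem one_le_chi {n : ℕ} (hn : 0 < n) : 1 ≤ chi n :=
  (isGreatest_chi hn).2 (one_mem_invEntrySet hn)

theorem chi_zero : chi 0 = 0 := by
  have h : invEntrySet 0 = ∅ := by
    ext t
    simp [invEntrySet]
  rw [chi, h, Real.sSup_empty]

/-! ### Inverse entries of matrices with arbitrary index types -/

theorem abs_inv_apply_le_chi {ι : Type*} [Fintype ι] [DecidableEq ι] {n : ℕ}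
    (hn : Fintype.card ι = n) (A : Matrix ι ι ℝ) (hA : ∀ i j, A i j = 0 ∨ A i j = 1)
    (hdet : A.det ≠ 0) (i j : ι) : |A⁻¹ i j| ≤ chi n := by
  have e : ι ≃ Fin n := Fintype.equivFinOfCardEq hn
  have hpos : 0 < n := hn ▸ Fintype.card_pos_iff.2 ⟨i⟩
  refine (isGreatest_chi hpos).2
    ⟨A.submatrix e.symm e.symm, fun _ _ => hA _ _, ?_, e i, e j, ?_⟩
  · rwa [Matrix.det_submatrix_equiv_self]
  · rw [Matrix.inv_submatrix_equiv]
    simp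

/-- Couple optimal matrices A and B by one unit entry E in the lower left block. The inverse has
lower left block -B⁻¹EA⁻¹, and placing E at (p, q) makes one of its entries the product of the two
extremal inverse entries, up to sign. -/
theorem chi_mul_chi_le {a b : ℕ} (ha : 0 < a) (hb : 0 < b) : chi a * chi b ≤ chi (a + b) := by
  obtain ⟨A, hA, hAd, q, j, hq⟩ := (isGreatest_chi ha).1
  obtain ⟨B, hB, hBd, i, p, hp⟩ := (isGreatest_chi hb).1
  have hAu : IsUnit A := (Matrix.isUnit_iff_isUnit_det A).2 hAd.isUnit
  have hBu : IsUnit B := (Matrix.isUnit_iff_isUnit_det B).2 hBd.isUnit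
  set M := Matrix.fromBlocks A 0 (Matrix.single p q (1 : ℝ)) B with hM
  have hent : M⁻¹ (Sum.inr i) (Sum.inl j) = -(B⁻¹ i p * A⁻¹ q j) := by
    rw [hM, Matrix.inv_fromBlocks_zero₁₂_of_isUnit_iff _ _ _ (by simp [hAu, hBu])]
    simp [Matrix.mul_apply, Matrix.single_apply, Finset.sum_ite_eq, ite_and]
  have h := abs_inv_apply_le_chi (n := a + b) (by simp) M ?_ ?_ (Sum.inr i) (Sum.inl j)
  · rw [hent, abs_neg, abs_mul] at h
    rw [hq, hp, mul_comm]
    exact h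
  · rintro (k | k) (l | l)
    · exact hA k l
    · exact Or.inl rfl
    · by_cases h : p = k ∧ q = l <;> simp [hM, h]
    · exact hB k l
  · rw [hM, Matrix.det_fromBlocks_zero₁₂]
    exact mul_ne_zero hAd hBd

theorem chi_mono {a b : ℕ} (ha : 0 < a) (hab : a ≤ b) : chi a ≤ chi b := by
  obtain rfl | h := hab.eq_or_lt
  · rfl
  · have h1 := chi_mul_chi_le ha (Nat.sub_pos_of_lt h)
    rw [Nat.add_sub_cancel' hab] at h1
    have h2 := one_le_chi ha
    have h3 := one_le_chi (Nat.sub_pos_of_lt h)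
    nlinarith

/-- A solution of a linear system with a `0/1` matrix and right hand side `t • e_j` bounds
the maximal inverse entry from below. -/
theorem abs_le_mul_chi_of_mulVec_eq {ι : Type*} [Fintype ι] [DecidableEq ι] {n : ℕ}
    (hn : Fintype.card ι = n) (A : Matrix ι ι ℝ) (hA : ∀ i j, A i j = 0 ∨ A i j = 1)
    (hinj : Function.Injective A.mulVec) (y : ι → ℝ) (j : ι) (t : ℝ)
    (hy : A.mulVec y = Pi.single j t) (i : ι) : |y i| ≤ |t| * chi n := by
  have hu : IsUnit A := Matrix.mulVec_injective_iff_isUnit.1 hinj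
  have hd : IsUnit A.det := (Matrix.isUnit_iff_isUnit_det A).1 hu
  have h : y = A⁻¹.mulVec (Pi.single j t) := by
    rw [← hy, Matrix.mulVec_mulVec, Matrix.nonsing_inv_mul A hd, Matrix.one_mulVec]
  have h' : y i = A⁻¹ i j * t := by
    rw [h]
    simp
  rw [h', abs_mul, mul_comm]
  exact mul_le_mul_of_nonneg_left (abs_inv_apply_le_chi hn A hA hd.ne_zero i j) (abs_nonneg t)

/-! ### Determinants of `0/1` matrices -/

theorem abs_det_le_rho {n : ℕ} (hn : 0 < n) (A : Matrix (Fin n) (Fin n) ℝ)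
    (hA : IsZeroOneMatrix A) : |A.det| ≤ rho n := by
  rcases le_total 0 A.det with h | h
  · rw [abs_of_nonneg h]
    exact (isGreatest_rho n).2 ⟨A, hA, rfl⟩
  · rw [abs_of_nonpos h]
    -- A row swap changes the sign of the determinant; order 1 has no rows to swap, but its
    -- determinant is never negative.
    obtain rfl | h1 : n = 1 ∨ 1 < n := by omega
    · rw [Matrix.det_fin_one] at h ⊢
      rcases hA 0 0 with h0 | h0
      · exact (isGreatest_rho 1).2 ⟨A, hA, by simp [h0]⟩
      · rw [h0] at h
        norm_num at h
    · refine (isGreatest_rho n).2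
        ⟨A.submatrix (Equiv.swap ⟨0, hn⟩ ⟨1, h1⟩) id, fun _ _ => hA _ _, ?_⟩
      rw [Matrix.det_permute, Equiv.Perm.sign_swap (by simp)]
      simp

/-- Hadamard's inequality for real matrices with entries in `[-1, 1]`. -/
theorem abs_det_le_of_abs_le_one {n : ℕ} (A : Matrix (Fin n) (Fin n) ℝ)
    (hA : ∀ i j, |A i j| ≤ 1) : |A.det| ≤ Real.sqrt n ^ n := by
  rcases Nat.eq_zero_or_pos n with rfl | hn
  · simp
  have : Fact (Module.finrank ℝ (EuclideanSpace ℝ (Fin n)) = n) := ⟨by simp⟩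
  let b := EuclideanSpace.basisFun (Fin n) ℝ
  let o := b.toBasis.orientation
  have h := o.abs_volumeForm_apply_le (fun i => WithLp.toLp 2 (A.row i))
  have hd : o.volumeForm (fun i => WithLp.toLp 2 (A.row i)) = A.det := by
    rw [o.volumeForm_robust b rfl, Module.Basis.det_apply, ← Matrix.det_transpose]
    congr 1
  rw [hd] at h
  refine h.trans ?_
  calc ∏ i, ‖WithLp.toLp 2 (A.row i)‖ ≤ ∏ _i : Fin n, Real.sqrt n := by
        refine Finset.prod_le_prod (fun _ _ => norm_nonneg _) fun i _ => ?_
        rw [EuclideanSpace.norm_eq]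
        refine Real.sqrt_le_sqrt ?_
        calc ∑ j, ‖(WithLp.toLp 2 (A.row i) : EuclideanSpace ℝ (Fin n)) j‖ ^ 2
            ≤ ∑ _j : Fin n, (1 : ℝ) := Finset.sum_le_sum fun j _ => by
              have := hA i j
              simp only [Matrix.row, Real.norm_eq_abs]
              exact pow_le_one₀ (abs_nonneg _) this
          _ = n := by simp
    _ = Real.sqrt n ^ n := by simp

/-- Map 0, 1 to 1, -1 and border with ones to get the ±1 matrix `M`. Subtracting its first row from
the others gives `N`, whose determinant is (-2)^n det A; Hadamard's inequality applies to `M`. -/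
theorem det_le_of_isZeroOneMatrix {n : ℕ} (A : Matrix (Fin n) (Fin n) ℝ)
    (hA : IsZeroOneMatrix A) : 2 ^ n * |A.det| ≤ Real.sqrt (n + 1 : ℕ) ^ (n + 1) := by
  let M : Matrix (Fin (n + 1)) (Fin (n + 1)) ℝ :=
    Matrix.of (Fin.cons (fun _ => 1) fun i => Fin.cons 1 fun j => 1 - 2 * A i j)
  let N : Matrix (Fin (n + 1)) (Fin (n + 1)) ℝ :=
    Matrix.of (Fin.cons (fun _ => 1) fun i => Fin.cons 0 fun j => (-2 * A i j))
  have hMN : M.det = N.det := by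
    refine Matrix.det_eq_of_forall_row_eq_smul_add_const (Fin.cons 0 fun _ => 1) 0 rfl ?_
    intro i j
    refine Fin.cases ?_ (fun i => ?_) i
    · simp [M, N]
    · refine Fin.cases ?_ (fun j => ?_) j
      · simp [M, N]
      · simp [M, N]
        ring
  have hN : N.det = (-2) ^ n * A.det := by
    rw [Matrix.det_succ_column_zero, Fin.sum_univ_succ]
    have : N.submatrix (Fin.succAbove 0) Fin.succ = (-2 : ℝ) • A := by
      ext i j
      simp [N]
    rw [this, Matrix.det_smul]
    simp [N]
  have h := abs_det_le_of_abs_le_one M ?_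
  · rw [hMN, hN, abs_mul, abs_pow] at h
    simpa using h
  · intro i j
    refine Fin.cases ?_ (fun i => ?_) i
    · simp [M]
    · refine Fin.cases ?_ (fun j => ?_) j
      · simp [M]
      · rcases hA i j with h | h <;> (simp [M, h]; try norm_num)

theorem rho_le {d : ℕ} (hd : 2 ≤ d) :
    rho (d - 1) ≤ (d : ℝ) ^ ((d : ℝ) / 2) / (2 : ℝ) ^ ((d : ℝ) - 1) := by
  obtain ⟨n, rfl⟩ : ∃ n, d = n + 1 := ⟨d - 1, by omega⟩
  obtain ⟨A, hA, h⟩ := (isGreatest_rho n).1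
  have h1 := det_le_of_isZeroOneMatrix A hA
  have h2 : ((n + 1 : ℕ) : ℝ) ^ (((n + 1 : ℕ) : ℝ) / 2) = Real.sqrt (n + 1 : ℕ) ^ (n + 1) := by
    rw [Real.sqrt_eq_rpow, ← Real.rpow_natCast, ← Real.rpow_mul (by positivity)]
    congr 1
    ring
  have h3 : (2 : ℝ) ^ (((n + 1 : ℕ) : ℝ) - 1) = 2 ^ n := by
    rw [← Real.rpow_natCast]
    congr 1
    push_cast
    ring
  rw [h2, h3, Nat.add_sub_cancel, h, le_div_iff₀ (by positivity), mul_comm]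
  exact le_trans (mul_le_mul_of_nonneg_left (le_abs_self _) (by positivity)) h1

/-! ### Faces of polytopes -/

/-- A convex combination of nonnegative values vanishes only if every point of nonzero weight has
value zero. -/
theorem face_convexHull_subset {d : ℕ} (c₀ : ℤ) (c : Fin d → ℤ) (V : Set (Fin d → ℝ))
    (hV : ∀ v ∈ V, 0 ≤ (c₀ : ℝ) + ∑ i, (c i : ℝ) * v i) :
    face c₀ c (convexHull ℝ V) ⊆
      convexHull ℝ {v ∈ V | (c₀ : ℝ) + ∑ i, (c i : ℝ) * v i = 0} := by
  rintro x ⟨hx, hx0⟩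
  obtain ⟨ι, _, w, z, hw, hw1, hz, rfl⟩ := mem_convexHull_iff_exists_fintype.1 hx
  have key : (c₀ : ℝ) + ∑ i, (c i : ℝ) * (∑ k, w k • z k) i =
      ∑ k, w k * ((c₀ : ℝ) + ∑ i, (c i : ℝ) * z k i) := by
    simp only [mul_add, Finset.sum_add_distrib, ← Finset.sum_mul, hw1, one_mul]
    congr 1
    simp only [Finset.sum_apply, Pi.smul_apply, smul_eq_mul, Finset.mul_sum]
    rw [Finset.sum_comm]
    exact Finset.sum_congr rfl fun _ _ => Finset.sum_congr rfl fun _ _ => by ring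
  rw [key, Finset.sum_eq_zero_iff_of_nonneg
    fun k _ => mul_nonneg (hw k) (hV _ (hz k))] at hx0
  have hsum : ∑ k, w k • z k = ∑ k with w k ≠ 0, w k • z k := by
    rw [Finset.sum_filter_of_ne]
    intro k _ h h'
    simp [h'] at h
  rw [hsum]
  refine (convex_convexHull ℝ _).sum_mem (fun k _ => hw k) ?_ fun k hk => subset_convexHull ℝ _ ?_
  · rw [Finset.sum_filter_ne_zero, hw1]
  · exact ⟨hz k, (mul_eq_zero.1 (hx0 k (Finset.mem_univ k))).resolve_left
      (Finset.mem_filter.1 hk).2⟩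

theorem affineDim_convexHull {d : ℕ} (V : Set (Fin d → ℝ)) :
    affineDim (convexHull ℝ V) = affineDim V := by
  rw [affineDim, affineDim, ← direction_affineSpan, affineSpan_convexHull, direction_affineSpan]

theorem affineDim_mono {d : ℕ} {S T : Set (Fin d → ℝ)} (h : S ⊆ T) :
    affineDim S ≤ affineDim T :=
  Submodule.finrank_mono (vectorSpan_mono ℝ h)

/-! ### Facet coefficients are bounded by determinants -/

/-- A primitive integer vector orthogonal to `n` linearly independent `0/1` vectors in dimension
`n + 1` is bounded by the maximal determinant. -/
theorem abs_le_rho_of_mulVec_eq_zero {n : ℕ} (hn : 0 < n) (M : Fin n → Fin (n + 1) → ℤ)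
    (hM : ∀ k q, M k q = 0 ∨ M k q = 1)
    (hlin : LinearIndependent ℝ fun k q => (M k q : ℝ)) (c : Fin (n + 1) → ℤ)
    (hc : Finset.univ.gcd c = 1) (hMc : ∀ k, ∑ q, M k q * c q = 0) (q : Fin (n + 1)) :
    |(c q : ℝ)| ≤ rho n := by
  obtain ⟨u, hu⟩ := Finset.gcd_eq_sum_mul Finset.univ c
  rw [hc] at hu
  -- Bézout coefficients `u` of `c` as an extra row give N c = e₀. Since `c` kills the other rows
  -- but not `u`, `N` is invertible, and multiplying by the adjugate shows that det N · c_q is a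
  -- signed n × n minor of `M`.
  let N : Matrix (Fin (n + 1)) (Fin (n + 1)) ℤ := Matrix.of (Fin.cons u M)
  have hNc : N.mulVec c = Pi.single 0 1 := by
    ext k
    refine Fin.cases ?_ (fun k => ?_) k
    · simp [N, Matrix.mulVec, dotProduct, hu, mul_comm]
    · simp [N, Matrix.mulVec, dotProduct, hMc]
  have hdet : N.det ≠ 0 := by
    have hNr : IsUnit (N.map (Int.castRingHom ℝ)) := by
      rw [← Matrix.linearIndependent_rows_iff_isUnit]
      have : (N.map (Int.castRingHom ℝ)).row =
          Fin.cons (fun q => (u q : ℝ)) fun k q => (M k q : ℝ) := by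
        ext k q
        refine Fin.cases ?_ (fun k => ?_) k <;> simp [N, Matrix.row]
      rw [this, linearIndependent_finCons]
      refine ⟨hlin, fun hmem => ?_⟩
      let f : (Fin (n + 1) → ℝ) →ₗ[ℝ] ℝ := Fintype.linearCombination ℝ fun q => (c q : ℝ)
      have hle : Submodule.span ℝ (Set.range fun (k : Fin n) q => (M k q : ℝ)) ≤
          LinearMap.ker f := by
        rw [Submodule.span_le]
        rintro _ ⟨k, rfl⟩
        simp only [SetLike.mem_coe, LinearMap.mem_ker, f, Fintype.linearCombination_apply,
          smul_eq_mul]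
        exact_mod_cast hMc k
      have h0 := hle hmem
      simp only [LinearMap.mem_ker, f, Fintype.linearCombination_apply, smul_eq_mul] at h0
      have h1 : ∑ q, u q * c q = 0 := by exact_mod_cast h0
      simp only [mul_comm] at h1 hu
      omega
    intro h0
    have h2 := (Matrix.isUnit_iff_isUnit_det _).1 hNr
    rw [← RingHom.mapMatrix_apply, ← RingHom.map_det, h0] at h2
    simp at h2
  have hcq : N.det * c q = N.adjugate q 0 := by
    have h := congrArg (fun v => (N.adjugate.mulVec v) q) hNc
    simpa [Matrix.mulVec_mulVec, Matrix.adjugate_mul, Matrix.smul_mulVec] using h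
  rw [Matrix.adjugate_fin_succ_eq_det_submatrix] at hcq
  have habs : |c q| ≤ |(N.submatrix (Fin.succAbove 0) q.succAbove).det| := by
    have h := congrArg abs hcq
    simp only [abs_mul, abs_pow, abs_neg, abs_one, one_pow, one_mul] at h
    rw [← h]
    exact le_mul_of_one_le_left (abs_nonneg _) (Int.one_le_abs hdet)
  let R : Matrix (Fin n) (Fin n) ℝ :=
    (N.submatrix (Fin.succAbove 0) q.succAbove).map (Int.castRingHom ℝ)
  have hR : IsZeroOneMatrix R := by
    intro k l
    rcases hM k (q.succAbove l) with h | h <;> simp [R, N, h]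
  have hRd : R.det = ((N.submatrix (Fin.succAbove 0) q.succAbove).det : ℝ) := by
    simp only [R]
    rw [← RingHom.mapMatrix_apply, ← RingHom.map_det]
    rfl
  refine le_trans ?_ (abs_det_le_rho hn R hR)
  rw [hRd]
  exact_mod_cast habs

theorem gcd_sign_mul_eq_one {ι : Type*} [Fintype ι] (σ c : ι → ℤ) (hσ : ∀ q, σ q * σ q = 1)
    (hc : Finset.univ.gcd c = 1) : (Finset.univ.gcd fun q => σ q * c q) = 1 := by
  have h : (Finset.univ.gcd fun q => σ q * c q) ∣ 1 := by
    rw [← hc]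
    refine Finset.dvd_gcd fun q _ => ?_
    have h1 : (Finset.univ.gcd fun q => σ q * c q) ∣ σ q * c q :=
      Finset.gcd_dvd (Finset.mem_univ q)
    have h2 := h1.mul_left (σ q)
    rwa [← mul_assoc, hσ, one_mul] at h2
  refine Int.eq_one_of_dvd_one ?_ h
  rw [← Finset.normalize_gcd, ← Int.abs_eq_normalize]
  exact abs_nonneg _

theorem natCast_le_rho_of_mem_coeffSet {d : ℕ} (hd : 2 ≤ d) {k : ℕ} (hk : k ∈ coeffSet d) :
    (k : ℝ) ≤ rho (d - 1) := by
  obtain ⟨n, rfl⟩ : ∃ n, d = n + 1 := ⟨d - 1, by omega⟩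
  obtain ⟨P, c₀, c, ⟨V, hV, rfl⟩, -, hgcd, ⟨hval, hne, hdim⟩, i, rfl⟩ := hk
  rw [Nat.add_sub_cancel]
  have hsub := face_convexHull_subset c₀ c V fun v hv => hval v (subset_convexHull ℝ V hv)
  set V₀ : Set (Fin (n + 1) → ℝ) := {v ∈ V | (c₀ : ℝ) + ∑ i, (c i : ℝ) * v i = 0} with hV₀
  obtain ⟨v₀, hv₀⟩ : V₀.Nonempty := by
    rw [← convexHull_nonempty_iff (𝕜 := ℝ)]
    exact hne.mono hsub
  have hdim' : n ≤ affineDim V₀ := by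
    have := affineDim_mono hsub
    rw [affineDim_convexHull] at this
    omega
  rw [affineDim, vectorSpan_eq_span_vsub_set_right ℝ hv₀] at hdim'
  obtain ⟨b, hb, hspan, hlin⟩ := exists_linearIndependent ℝ ((fun x => x -ᵥ v₀) '' V₀)
  have hbfin : Finite b := hlin.finite
  have := Fintype.ofFinite b
  have hcard : n ≤ Fintype.card b := by
    rw [← hspan, finrank_span_set_eq_card hlin, Set.toFinset_card] at hdim'
    exact hdim'
  obtain ⟨e⟩ : Nonempty (Fin n ↪ b) :=
    Function.Embedding.nonempty_of_card_le (by simpa using hcard)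
  have hlin' : LinearIndependent ℝ fun k : Fin n => ((e k : b) : Fin (n + 1) → ℝ) :=
    hlin.comp e e.injective
  choose v hvV hve using fun k : Fin n => hb (e k).2
  -- Reflecting x_q to 1 - x_q wherever v₀ has coordinate 1 moves v₀ to the origin, so the
  -- differences v_k - v₀ become 0/1 vectors `M k`. The normal changes only by signs.
  let σ : Fin (n + 1) → ℤ := fun q => if v₀ q = 0 then 1 else -1
  have hσ : ∀ q, σ q = 1 ∨ σ q = -1 := fun q => by simp only [σ]; split_ifs <;> simp
  let M : Fin n → Fin (n + 1) → ℤ := fun k q => if v k q = v₀ q then 0 else 1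
  have hMv : ∀ k q, (M k q : ℝ) = σ q * (v k q - v₀ q) := by
    intro k q
    rcases hV _ (hvV k).1 q with h1 | h1 <;> rcases hV _ hv₀.1 q with h2 | h2 <;>
      simp [M, σ, h1, h2]
  have hσσ : ∀ q, σ q * σ q = 1 := fun q => by rcases hσ q with h | h <;> simp [h]
  have hvorth : ∀ k, ∑ q, (v k q - v₀ q) * (c q : ℝ) = 0 := by
    intro k
    have h1 := (hvV k).2
    have h2 := hv₀.2
    simp only [sub_mul, Finset.sum_sub_distrib]
    simp only [mul_comm (_ : ℝ) (c _ : ℝ)]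
    linarith
  have h := abs_le_rho_of_mulVec_eq_zero (by omega) M
    (fun k q => by simp only [M]; split_ifs <;> simp) ?_ (fun q => σ q * c q) ?_ ?_ i
  · rw [Nat.cast_natAbs, Int.cast_abs]
    refine le_trans (le_of_eq ?_) h
    rcases hσ i with h | h <;> simp [h]
  · let f : (Fin (n + 1) → ℝ) →ₗ[ℝ] (Fin (n + 1) → ℝ) :=
      LinearMap.pi fun q => (σ q : ℝ) • LinearMap.proj q
    have hf : ∀ x q, f x q = σ q * x q := fun _ _ => rfl
    have hfker : LinearMap.ker f = ⊥ := by
      rw [LinearMap.ker_eq_bot']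
      intro x hx
      ext q
      have h1 : (σ q : ℝ) * x q = 0 := congrFun hx q
      rcases hσ q with h | h <;> simpa [h] using h1
    have hfun : (fun k q => (M k q : ℝ)) = f ∘ fun k : Fin n => ((e k : b) : Fin (n + 1) → ℝ) := by
      ext k q
      rw [hMv, Function.comp_apply, hf, ← hve k]
      rfl
    rw [hfun]
    exact hlin'.map' f hfker
  · exact gcd_sign_mul_eq_one σ c hσσ hgcd
  · intro k
    have : (∑ q, (M k q : ℝ) * ((σ q : ℝ) * (c q : ℝ))) = 0 := by
      rw [← hvorth k]
      refine Finset.sum_congr rfl fun q _ => ?_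
      have : (σ q : ℝ) * σ q = 1 := by exact_mod_cast hσσ q
      rw [hMv]
      linear_combination (v k q - v₀ q) * (c q : ℝ) * this
    exact_mod_cast this

/-! ### Facets with coefficients at least as large as inverse entries -/

/-- A primitive integer vector orthogonal to `n` linearly independent `0/1` vectors in dimension
`n + 1`, with positive last coordinate, defines a facet through the origin of a full-dimensional
`0/1`-polytope. -/
theorem natAbs_mem_coeffSet {n : ℕ} (b : Fin n → Fin (n + 1) → ℝ)
    (hb : ∀ k q, b k q = 0 ∨ b k q = 1) (hlin : LinearIndependent ℝ b) (c : Fin (n + 1) → ℤ)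
    (hc : Finset.univ.gcd c = 1) (hbc : ∀ k, ∑ q, (c q : ℝ) * b k q = 0)
    (hpos : 0 < c (Fin.last n)) (q : Fin (n + 1)) : (c q).natAbs ∈ coeffSet (n + 1) := by
  let f : (Fin (n + 1) → ℝ) →ₗ[ℝ] ℝ := ∑ q, (c q : ℝ) • LinearMap.proj q
  have hf : ∀ x, f x = ∑ q, (c q : ℝ) * x q := fun x => by simp [f]
  let e : Fin (n + 1) → ℝ := Pi.single (Fin.last n) 1
  have hfe : f e = c (Fin.last n) := by simp [hf, e, Pi.single_apply]
  have hfe0 : 0 < f e := by rw [hfe]; exact_mod_cast hpos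
  -- The origin and the `b k` span the facet; the unit vector `e`, strictly on the positive side,
  -- makes the polytope full-dimensional.
  let V : Set (Fin (n + 1) → ℝ) := insert 0 (insert e (Set.range b))
  have hVP : V ⊆ convexHull ℝ V := subset_convexHull ℝ V
  have h0V : (0 : Fin (n + 1) → ℝ) ∈ V := Set.mem_insert _ _
  have heV : e ∈ V := Set.mem_insert_of_mem _ (Set.mem_insert _ _)
  have hbV : ∀ k, b k ∈ V := fun k =>
    Set.mem_insert_of_mem _ (Set.mem_insert_of_mem _ ⟨k, rfl⟩)
  have hface : face 0 c (convexHull ℝ V) = {x ∈ convexHull ℝ V | f x = 0} := by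
    simp [face, hf]
  have h0F : (0 : Fin (n + 1) → ℝ) ∈ face 0 c (convexHull ℝ V) := by
    rw [hface]
    exact ⟨hVP h0V, map_zero f⟩
  have hbF : ∀ k, b k ∈ face 0 c (convexHull ℝ V) := fun k => by
    rw [hface]
    exact ⟨hVP (hbV k), by rw [hf, hbc k]⟩
  have hlt : LinearMap.ker f < ⊤ := by
    rw [lt_top_iff_ne_top]
    intro h
    have : e ∈ LinearMap.ker f := h ▸ Submodule.mem_top
    rw [LinearMap.mem_ker] at this
    exact hfe0.ne' this
  have hker : Module.finrank ℝ (LinearMap.ker f) < n + 1 := by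
    have := Submodule.finrank_lt (lt_top_iff_ne_top.1 hlt)
    simpa using this
  have hFle : vectorSpan ℝ (face 0 c (convexHull ℝ V)) ≤ LinearMap.ker f := by
    rw [vectorSpan_eq_span_vsub_set_right ℝ h0F, Submodule.span_le]
    rintro _ ⟨x, hx, rfl⟩
    rw [hface] at hx
    simpa using hx.2
  have hFge : n ≤ affineDim (face 0 c (convexHull ℝ V)) := by
    have h1 : Submodule.span ℝ (Set.range b) ≤ vectorSpan ℝ (face 0 c (convexHull ℝ V)) := by
      rw [vectorSpan_eq_span_vsub_set_right ℝ h0F]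
      refine Submodule.span_mono ?_
      rintro _ ⟨k, rfl⟩
      exact ⟨b k, hbF k, by simp⟩
    have h2 := Submodule.finrank_mono h1
    rwa [finrank_span_eq_card hlin, Fintype.card_fin] at h2
  have hFn : affineDim (face 0 c (convexHull ℝ V)) = n :=
    le_antisymm (by have := Submodule.finrank_mono hFle; unfold affineDim; omega) hFge
  have hPlt : vectorSpan ℝ (face 0 c (convexHull ℝ V)) < vectorSpan ℝ (convexHull ℝ V) := by
    refine lt_of_le_of_ne (vectorSpan_mono ℝ fun x hx => hx.1) fun h => ?_
    have h1 : e - 0 ∈ vectorSpan ℝ (convexHull ℝ V) :=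
      vsub_mem_vectorSpan ℝ (hVP heV) (hVP h0V)
    rw [← h, sub_zero] at h1
    exact hfe0.ne' (hFle h1)
  refine ⟨convexHull ℝ V, 0, c, ⟨V, ?_, rfl⟩, ⟨⟨0, hVP h0V⟩, ?_⟩, hc,
    ⟨?_, ⟨0, h0F⟩, by rw [hFn]⟩, q, rfl⟩
  · rintro v (rfl | rfl | ⟨k, rfl⟩) i
    · exact Or.inl rfl
    · by_cases h : i = Fin.last n <;> simp [e, h]
    · exact hb k i
  · refine le_antisymm ?_ ?_
    · have := Submodule.finrank_le (vectorSpan ℝ (convexHull ℝ V))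
      simpa [affineDim] using this
    · have := Submodule.finrank_lt_finrank_of_lt hPlt
      unfold affineDim at hFn ⊢
      omega
  · have hsub : convexHull ℝ V ⊆ {x | 0 ≤ f x} := by
      refine convexHull_min ?_ (convex_halfSpace_ge f.isLinear 0)
      rintro v (rfl | rfl | ⟨k, rfl⟩)
      · simp
      · exact hfe0.le
      · simp [hf, hbc k]
    intro x hx
    have := hsub hx
    simpa [hf] using this

theorem exists_mem_coeffSet_abs_inv_le {n : ℕ} (A : Matrix (Fin n) (Fin n) ℝ)
    (hA : IsZeroOneMatrix A) (hdet : A.det ≠ 0) (i j : Fin n) :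
    ∃ k ∈ coeffSet (n + 1), |A⁻¹ i j| ≤ (k : ℝ) := by
  let Z : Matrix (Fin n) (Fin n) ℤ := Matrix.of fun k l => if A k l = 0 then 0 else 1
  have hZ : Z.map (Int.castRingHom ℝ) = A := by
    ext k l
    rcases hA k l with h | h <;> simp [Z, h]
  have hZd : (Z.det : ℝ) = A.det := by
    rw [← hZ, ← RingHom.mapMatrix_apply, ← RingHom.map_det]
    rfl
  have hZd0 : Z.det ≠ 0 := fun h => hdet (by rw [← hZd, h]; simp)
  -- This is det A · (-A⁻¹e_j, 1), made integral by the adjugate; it is orthogonal to the rows of (A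
  -- | e_j).
  let c' : Fin (n + 1) → ℤ := Fin.snoc (fun l => -Z.adjugate l j) Z.det
  let b : Fin n → Fin (n + 1) → ℝ := fun k => Fin.snoc (A k) (if k = j then 1 else 0)
  have hb : ∀ k q, b k q = 0 ∨ b k q = 1 := by
    intro k q
    refine Fin.lastCases ?_ (fun l => ?_) q
    · by_cases h : k = j <;> simp [b, h]
    · simpa [b] using hA k l
  have hbc' : ∀ k, ∑ q, (c' q : ℝ) * b k q = 0 := by
    intro k
    have h1 : ∑ l, Z k l * Z.adjugate l j = Z.det * (1 : Matrix (Fin n) (Fin n) ℤ) k j := by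
      rw [← Matrix.mul_apply, Matrix.mul_adjugate]
      simp
    have h2 : ∑ l, A k l * (Z.adjugate l j : ℝ) = Z.det * (if k = j then 1 else 0) := by
      have h3 := congrArg (Int.cast : ℤ → ℝ) h1
      rw [← hZ]
      simpa [Matrix.one_apply] using h3
    rw [Fin.sum_univ_castSucc]
    simp only [c', b, Fin.snoc_castSucc, Fin.snoc_last, Int.cast_neg, neg_mul,
      Finset.sum_neg_distrib]
    rw [← h2, neg_add_eq_zero]
    exact Finset.sum_congr rfl fun _ _ => mul_comm _ _
  have hlin : LinearIndependent ℝ b := by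
    have h1 : LinearIndependent ℝ A.row := Matrix.linearIndependent_rows_iff_isUnit.2
      ((Matrix.isUnit_iff_isUnit_det A).2 hdet.isUnit)
    refine LinearIndependent.of_comp (LinearMap.funLeft ℝ ℝ Fin.castSucc) ?_
    have h2 : LinearMap.funLeft ℝ ℝ Fin.castSucc ∘ b = A.row := by
      ext k l
      simp [b, Matrix.row, LinearMap.funLeft_apply]
    rwa [h2]
  obtain ⟨g, hg, hg1⟩ := Finset.extract_gcd (s := Finset.univ) c' Finset.univ_nonempty
  set t := Finset.univ.gcd c' with ht
  have hlast : Z.det = t * g (Fin.last n) := by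
    rw [← hg _ (Finset.mem_univ _)]
    simp [c']
  have ht0 : t ≠ 0 := fun h => hZd0 (by rw [hlast, h, zero_mul])
  have hgl0 : g (Fin.last n) ≠ 0 := fun h => hZd0 (by rw [hlast, h, mul_zero])
  have hbg : ∀ k, ∑ q, (g q : ℝ) * b k q = 0 := by
    intro k
    have h1 := hbc' k
    have h2 : ∑ q, (c' q : ℝ) * b k q = t * ∑ q, (g q : ℝ) * b k q := by
      rw [Finset.mul_sum]
      refine Finset.sum_congr rfl fun q _ => ?_
      rw [hg q (Finset.mem_univ q)]
      push_cast
      ring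
    rw [h2] at h1
    exact (mul_eq_zero.1 h1).resolve_left (by exact_mod_cast ht0)
  have hmem : (g i.castSucc).natAbs ∈ coeffSet (n + 1) := by
    -- The facet construction needs a positive last coordinate; negating `g` changes no absolute
    -- value.
    rcases hgl0.lt_or_gt with h | h
    · have := natAbs_mem_coeffSet b hb hlin (fun q => -1 * g q)
        (gcd_sign_mul_eq_one (fun _ => -1) g (fun _ => by norm_num) hg1)
        (fun k => by simpa using hbg k) (by simpa using h) i.castSucc
      simpa using this
    · exact natAbs_mem_coeffSet b hb hlin g hg1 hbg h i.castSucc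
  refine ⟨_, hmem, ?_⟩
  have hinv : A⁻¹ i j * g (Fin.last n) = -g i.castSucc := by
    have h1 : A⁻¹ i j = (Z.adjugate i j : ℝ) / Z.det := by
      have h2 : (Z.adjugate i j : ℝ) = A.adjugate i j := by
        rw [← hZ, ← RingHom.mapMatrix_apply, ← RingHom.map_adjugate]
        rfl
      rw [Matrix.inv_def, h2, hZd]
      simp [div_eq_inv_mul]
    have h2 : (-Z.adjugate i j : ℤ) = t * g i.castSucc := by
      rw [← hg _ (Finset.mem_univ _)]
      simp [c']
    have h3 : (Z.adjugate i j : ℝ) = -(t * g i.castSucc) := by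
      rw [← Int.cast_mul, ← h2]
      simp
    have ht0' : (t : ℝ) ≠ 0 := by exact_mod_cast ht0
    have hgl0' : (g (Fin.last n) : ℝ) ≠ 0 := by exact_mod_cast hgl0
    rw [h1, h3, hlast]
    push_cast
    field_simp
  have h1 : (1 : ℝ) ≤ |(g (Fin.last n) : ℝ)| := by exact_mod_cast Int.one_le_abs hgl0
  have h2 := congrArg abs hinv
  rw [abs_mul, abs_neg] at h2
  rw [Nat.cast_natAbs, Int.cast_abs, ← h2]
  exact le_mul_of_one_le_right (abs_nonneg _) h1

theorem isGreatest_coeff {d : ℕ} (hd : 2 ≤ d) : IsGreatest (coeffSet d) (coeff d) := by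
  have hbdd : BddAbove (coeffSet d) := ⟨⌊rho (d - 1)⌋₊, fun k hk =>
    Nat.le_floor (natCast_le_rho_of_mem_coeffSet hd hk)⟩
  refine ⟨Nat.sSup_mem ?_ hbdd, fun k hk => le_csSup hbdd hk⟩
  obtain ⟨n, rfl⟩ : ∃ n, d = n + 1 := ⟨d - 1, by omega⟩
  have hn : 0 < n := by omega
  obtain ⟨k, hk, -⟩ := exists_mem_coeffSet_abs_inv_le (1 : Matrix (Fin n) (Fin n) ℝ)
    (isZeroOneMatrix_one n) (by simp) ⟨0, hn⟩ ⟨0, hn⟩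
  exact ⟨k, hk⟩

theorem coeff_le_rho {d : ℕ} (hd : 2 ≤ d) : (coeff d : ℝ) ≤ rho (d - 1) :=
  natCast_le_rho_of_mem_coeffSet hd (isGreatest_coeff hd).1

theorem chi_le_coeff {d : ℕ} (hd : 2 ≤ d) : chi (d - 1) ≤ coeff d := by
  obtain ⟨n, rfl⟩ : ∃ n, d = n + 1 := ⟨d - 1, by omega⟩
  obtain ⟨A, hA, hdet, i, j, h⟩ := (isGreatest_chi (n := n) (by omega)).1
  obtain ⟨k, hk, hle⟩ := exists_mem_coeffSet_abs_inv_le A hA hdet i j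
  rw [Nat.add_sub_cancel, h]
  exact hle.trans (by exact_mod_cast (isGreatest_coeff hd).2 hk)

/-! ### The subsets of `range m` with at least `k` elements, in binary order -/

/-- The subsets of `{0, …, m - 1}` with at least `k` elements, listed in the order of their binary
codes. -/
def binaryList : ℕ → ℕ → List (Finset ℕ)
  | 0, 0 => [∅]
  | 0, _ + 1 => []
  | m + 1, k => binaryList m k ++ (binaryList m (k - 1)).map (insert m)

theorem mem_binaryList {m k : ℕ} {a : Finset ℕ} :
    a ∈ binaryList m k ↔ a ⊆ Finset.range m ∧ k ≤ a.card := by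
  induction m generalizing k a with
  | zero =>
    cases k with
    | zero => simp [binaryList]
    | succ k =>
      simp only [binaryList, List.not_mem_nil, Finset.range_zero, Finset.subset_empty, false_iff]
      rintro ⟨rfl, h⟩
      simp at h
  | succ m ih =>
    simp only [binaryList, List.mem_append, List.mem_map, ih]
    constructor
    · rintro (⟨h1, h2⟩ | ⟨b, ⟨h1, h2⟩, rfl⟩)
      · exact ⟨h1.trans (Finset.range_subset_range.2 m.le_succ), h2⟩
      · have hm : m ∉ b := fun h => by simpa using h1 h
        rw [Finset.card_insert_of_notMem hm, Finset.range_add_one]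
        exact ⟨Finset.insert_subset_insert _ h1, by omega⟩
    · rintro ⟨h1, h2⟩
      by_cases hm : m ∈ a
      · refine Or.inr ⟨a.erase m, ⟨?_, ?_⟩, Finset.insert_erase hm⟩
        · rw [Finset.range_add_one] at h1
          exact Finset.subset_insert_iff.1 h1
        · rw [Finset.card_erase_of_mem hm]
          omega
      · rw [Finset.range_add_one] at h1
        exact Or.inl ⟨(Finset.subset_insert_iff_of_notMem hm).1 h1, h2⟩

theorem notMem_of_mem_binaryList {m k : ℕ} {a : Finset ℕ} (h : a ∈ binaryList m k) : m ∉ a :=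
  fun hm => by simpa using (mem_binaryList.1 h).1 hm

/-- No member of the list contains a later one. -/
theorem pairwise_binaryList (m k : ℕ) :
    (binaryList m k).Pairwise fun a b => ¬ b ⊆ a := by
  induction m generalizing k with
  | zero => cases k <;> simp [binaryList]
  | succ m ih =>
    rw [binaryList, List.pairwise_append]
    refine ⟨ih k, ?_, ?_⟩
    · rw [List.pairwise_map]
      refine (ih (k - 1)).imp_of_mem fun {a b} ha hb h h' => h ?_
      intro i hi
      have := h' (Finset.mem_insert_of_mem hi)
      rcases Finset.mem_insert.1 this with rfl | h2
      · exact absurd hi (notMem_of_mem_binaryList hb)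
      · exact h2
    · intro a ha b hb h
      obtain ⟨b, -, rfl⟩ := List.mem_map.1 hb
      exact notMem_of_mem_binaryList ha (h (Finset.mem_insert_self _ _))

theorem nodup_binaryList (m k : ℕ) : (binaryList m k).Nodup :=
  (pairwise_binaryList m k).imp fun {a b} h (h' : a = b) => h (h' ▸ subset_rfl)

theorem binaryList_eq_nil {m k : ℕ} (h : m < k) : binaryList m k = [] := by
  refine List.eq_nil_iff_forall_not_mem.2 fun a ha => ?_
  obtain ⟨h1, h2⟩ := mem_binaryList.1 ha
  have := Finset.card_le_card h1
  rw [Finset.card_range] at this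
  omega

theorem head?_binaryList {m k : ℕ} (h : k ≤ m) :
    (binaryList m k).head? = some (Finset.range k) := by
  induction m generalizing k with
  | zero =>
    obtain rfl : k = 0 := by omega
    rfl
  | succ m ih =>
    obtain h | rfl : k ≤ m ∨ k = m + 1 := by omega
    · simp [binaryList, List.head?_append, ih h]
    · simp [binaryList, binaryList_eq_nil, ih le_rfl, Finset.range_add_one]

theorem getLast?_binaryList {m k : ℕ} (h : k ≤ m) :
    (binaryList m k).getLast? = some (Finset.range m) := by
  induction m generalizing k with
  | zero =>
    obtain rfl : k = 0 := by omega
    rfl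
  | succ m ih =>
    simp [binaryList, List.getLast?_append, List.getLast?_map, ih (k := k - 1) (by omega),
      Finset.range_add_one]

/-- Each member of the list has exactly one element that is not in the preceding one. -/
theorem isChain_binaryList (m k : ℕ) :
    (binaryList m k).IsChain fun p a =>
      p ⊆ Finset.range m ∧ a ⊆ Finset.range m ∧ (a \ p).card = 1 := by
  induction m generalizing k with
  | zero => cases k <;> simp [binaryList]
  | succ m ih =>
    have hsub : Finset.range m ⊆ Finset.range (m + 1) :=
      Finset.range_subset_range.2 m.le_succ
    have hins : ∀ b, b ⊆ Finset.range m → insert m b ⊆ Finset.range (m + 1) := fun b hb => by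
      rw [Finset.range_add_one]
      exact Finset.insert_subset_insert _ hb
    rw [binaryList, List.isChain_append]
    refine ⟨(ih k).imp fun p a h => ⟨h.1.trans hsub, h.2.1.trans hsub, h.2.2⟩, ?_, ?_⟩
    · rw [List.isChain_map]
      refine (ih (k - 1)).imp fun p a h => ⟨hins _ h.1, hins _ h.2.1, ?_⟩
      have hm : m ∉ a := fun hm => by simpa using h.2.1 hm
      rw [← h.2.2]
      congr 1
      ext i
      by_cases hi : i = m
      · subst hi
        simp [hm]
      · simp [hi]
    -- At the junction of the two halves the last set is {0, …, m - 1} and the next is {0, …, k - 2}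
    -- ∪ {m} ({m} alone if k = 0), so `m` is the only new element. If k > m, the first half is
    -- empty.
    · intro p hp a ha
      by_cases hk : k ≤ m
      · rw [getLast?_binaryList hk] at hp
        rw [List.head?_map, head?_binaryList (by omega : k - 1 ≤ m)] at ha
        simp only [Option.mem_def, Option.some.injEq, Option.map_some] at hp ha
        subst hp ha
        have hk' : Finset.range (k - 1) ⊆ Finset.range m :=
          Finset.range_subset_range.2 (by omega)
        refine ⟨hsub, hins _ hk', ?_⟩
        rw [Finset.insert_sdiff_of_notMem _ (by simp), Finset.sdiff_eq_empty_iff_subset.2 hk']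
        rfl
      · rw [binaryList_eq_nil (by omega)] at hp
        simp at hp

/-! ### Characters of the Boolean cube -/

/-- The character `β ↦ (-1) ^ |γ ∩ β|`. -/
def walsh (γ β : Finset ℕ) : ℝ := ∏ i ∈ γ, if i ∈ β then -1 else 1

theorem walsh_empty_left (β : Finset ℕ) : walsh ∅ β = 1 := rfl

theorem walsh_empty_right (γ : Finset ℕ) : walsh γ ∅ = 1 := by simp [walsh]

theorem walsh_eq_or (γ β : Finset ℕ) : walsh γ β = 1 ∨ walsh γ β = -1 := by
  unfold walsh
  refine Finset.prod_induction _ (fun t : ℝ => t = 1 ∨ t = -1) ?_ (Or.inl rfl) ?_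
  · rintro a b (rfl | rfl) (rfl | rfl) <;> simp
  · intro _ _
    split_ifs <;> simp

theorem walsh_union {γ δ : Finset ℕ} (h : Disjoint γ δ) (β : Finset ℕ) :
    walsh (γ ∪ δ) β = walsh γ β * walsh δ β :=
  Finset.prod_union h

theorem walsh_eq_one_of_disjoint {γ β : Finset ℕ} (h : Disjoint γ β) : walsh γ β = 1 :=
  Finset.prod_eq_one fun _ hi => if_neg (Finset.disjoint_left.1 h hi)

theorem sum_powerset_walsh (C β : Finset ℕ) :
    ∑ γ ∈ C.powerset, walsh γ β = if Disjoint C β then 2 ^ C.card else 0 := by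
  unfold walsh
  rw [← Finset.prod_one_add]
  split_ifs with h
  · rw [← Finset.prod_const]
    refine Finset.prod_congr rfl fun i hi => ?_
    rw [if_neg (Finset.disjoint_left.1 h hi)]
    norm_num
  · obtain ⟨i, hi, hi'⟩ := Finset.not_disjoint_iff.1 h
    exact Finset.prod_eq_zero hi (by simp [hi'])

theorem sum_powerset_walsh_mul_walsh {U β β' : Finset ℕ} (hβ : β ⊆ U) (hβ' : β' ⊆ U) :
    ∑ γ ∈ U.powerset, walsh γ β * walsh γ β' = if β = β' then 2 ^ U.card else 0 := by
  unfold walsh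
  simp only [← Finset.prod_mul_distrib]
  rw [← Finset.prod_one_add]
  split_ifs with h
  · subst h
    rw [← Finset.prod_const]
    refine Finset.prod_congr rfl fun i _ => ?_
    split_ifs <;> norm_num
  · obtain ⟨i, hi⟩ : ∃ i, ¬ (i ∈ β ↔ i ∈ β') := by
      by_contra! h'
      exact h (Finset.ext h')
    have hiU : i ∈ U := by
      by_contra hU
      exact hi ⟨fun h => absurd (hβ h) hU, fun h => absurd (hβ' h) hU⟩
    refine Finset.prod_eq_zero hiU ?_
    by_cases h1 : i ∈ β <;> by_cases h2 : i ∈ β' <;> simp_all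

/-- A function on the subsets of `U` all of whose character sums vanish is zero. -/
theorem eq_zero_of_forall_sum_walsh_eq_zero {U : Finset ℕ} {y : Finset ℕ → ℝ}
    (h : ∀ γ ∈ U.powerset, ∑ β ∈ U.powerset, walsh γ β * y β = 0) :
    ∀ β ∈ U.powerset, y β = 0 := by
  intro β hβ
  have h1 : ∑ γ ∈ U.powerset, walsh γ β * ∑ β' ∈ U.powerset, walsh γ β' * y β' = 0 :=
    Finset.sum_eq_zero fun γ hγ => by rw [h γ hγ, mul_zero]
  simp only [Finset.mul_sum, ← mul_assoc] at h1
  rw [Finset.sum_comm] at h1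
  simp only [← Finset.sum_mul] at h1
  rw [Finset.sum_congr rfl fun β' hβ' => by
    rw [sum_powerset_walsh_mul_walsh (Finset.mem_powerset.1 hβ) (Finset.mem_powerset.1 hβ')]] at h1
  simpa [ite_mul, Finset.sum_ite_eq, Finset.mem_powerset.1 hβ] using h1

/-! ### The rows of the Alon–Vu matrix -/

/-- The `±1` row that links the coordinate of `a` to that of its predecessor `p`. -/
def stepRow (p a β : Finset ℕ) : ℝ :=
  (if Disjoint (p ∩ a) β then walsh (p \ a) β + walsh (a \ p) β else 0) - walsh p β

theorem walsh_eq_inter_mul_sdiff (p a β : Finset ℕ) :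
    walsh p β = walsh (p ∩ a) β * walsh (p \ a) β := by
  rw [← walsh_union (Finset.disjoint_sdiff_inter p a).symm, Finset.union_comm,
    Finset.sdiff_union_inter]

/-- If β misses p ∩ a, the characters of p and p \ a agree at β and cancel, leaving that of a \ p.
Otherwise only minus the character of p remains. -/
theorem stepRow_eq_or (p a β : Finset ℕ) : stepRow p a β = 1 ∨ stepRow p a β = -1 := by
  unfold stepRow
  split_ifs with h
  · rw [walsh_eq_inter_mul_sdiff p a, walsh_eq_one_of_disjoint h, one_mul,
      add_sub_cancel_left]
    exact walsh_eq_or _ _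
  · rcases walsh_eq_or p β with h | h <;> simp [h]

theorem stepRow_empty (p a : Finset ℕ) : stepRow p a ∅ = 1 := by
  simp [stepRow, walsh_empty_right]

/-- The indicator of β being disjoint from C is the average of the characters of all subsets of C.
Hence a step row is a combination of characters, and orthogonality to it becomes the `Linked`
relation between character sums. -/
theorem two_pow_mul_stepRow (p a β : Finset ℕ) :
    2 ^ (p ∩ a).card * stepRow p a β =
      ∑ γ ∈ (p ∩ a).powerset, (walsh (γ ∪ p \ a) β + walsh (γ ∪ a \ p) β)
        - 2 ^ (p ∩ a).card * walsh p β := by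
  have h1 : ∀ γ ∈ (p ∩ a).powerset, walsh (γ ∪ p \ a) β + walsh (γ ∪ a \ p) β =
      walsh γ β * (walsh (p \ a) β + walsh (a \ p) β) := by
    intro γ hγ
    rw [Finset.mem_powerset] at hγ
    rw [walsh_union, walsh_union, mul_add]
    · exact Finset.disjoint_of_subset_left (hγ.trans Finset.inter_subset_left)
        Finset.disjoint_sdiff
    · exact Finset.disjoint_of_subset_left (hγ.trans Finset.inter_subset_right)
        Finset.disjoint_sdiff
  rw [Finset.sum_congr rfl h1, ← Finset.sum_mul, sum_powerset_walsh, stepRow, mul_sub]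
  split_ifs <;> simp

/-- The rows of the Alon–Vu matrix for a list of sets: a linking row for each member of the list
but the first, and a character otherwise. -/
def listRow : List (Finset ℕ) → Finset ℕ → Finset ℕ → ℝ
  | p :: a :: l, α => if α = a then stepRow p a else listRow (a :: l) α
  | [_], α => walsh α
  | [], α => walsh α

theorem listRow_induction {P : (Finset ℕ → ℝ) → Prop} (hstep : ∀ p a, P (stepRow p a))
    (hwalsh : ∀ α, P (walsh α)) (l : List (Finset ℕ)) (α : Finset ℕ) : P (listRow l α) := by
  induction l with
  | nil => exact hwalsh α
  | cons p l ih =>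
    cases l with
    | nil => exact hwalsh α
    | cons a l =>
      rw [listRow]
      split_ifs
      · exact hstep p a
      · exact ih

theorem listRow_of_notMem {p α : Finset ℕ} {l : List (Finset ℕ)} (h : α ∉ l) :
    listRow (p :: l) α = walsh α := by
  induction l generalizing p with
  | nil => rfl
  | cons a l ih =>
    rw [List.mem_cons, not_or] at h
    rw [listRow, if_neg h.1, ih h.2]

theorem isChain_of_forall_listRow {P : (Finset ℕ → ℝ) → Prop} {p : Finset ℕ}
    {l : List (Finset ℕ)} (hl : (p :: l).Nodup) (h : ∀ α ∈ l, P (listRow (p :: l) α)) :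
    (p :: l).IsChain fun p a => P (stepRow p a) := by
  induction l generalizing p with
  | nil => simp
  | cons a l ih =>
    rw [List.isChain_cons_cons]
    refine ⟨?_, ih (List.nodup_cons.1 hl).2 fun α hα => ?_⟩
    · simpa [listRow] using h a (by simp)
    · have h1 := h α (List.mem_cons_of_mem _ hα)
      have h2 : α ≠ a := by
        rintro rfl
        exact (List.nodup_cons.1 (List.nodup_cons.1 hl).2).1 hα
      rwa [listRow, if_neg h2] at h1

/-! ### The linear recursion behind the Alon–Vu matrix -/

/-- The linking equation between the coordinates at `p` and `a`. -/
def Linked (x : Finset ℕ → ℝ) (p a : Finset ℕ) : Prop :=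
  (a \ p).card = 1 ∧
    ∑ γ ∈ (p ∩ a).powerset, (x (γ ∪ p \ a) + x (γ ∪ a \ p)) = 2 ^ (p ∩ a).card * x p

theorem Linked.card_inter {x : Finset ℕ → ℝ} {p a : Finset ℕ} (h : Linked x p a) :
    (p ∩ a).card = a.card - 1 := by
  have := Finset.card_sdiff_add_card_inter a p
  rw [h.1, Finset.inter_comm] at this
  omega

/-- The term γ = p ∩ a contributes x p + x a. All other terms sit at pairwise distinct proper
subsets of p or of a: those of the second kind contain the one element of a \ p, those of the first
do not. Terms outside `S` vanish. -/
theorem Linked.exists_eq_sub_sum {x : Finset ℕ → ℝ} {p a : Finset ℕ} (h : Linked x p a)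
    {S : Finset (Finset ℕ)} (hS : ∀ b, b ≠ p → (b ⊂ p ∨ b ⊂ a) → x b = 0 ∨ b ∈ S) :
    ∃ W ⊆ S, x a = (2 ^ (p ∩ a).card - 1) * x p - ∑ b ∈ W, x b := by
  obtain ⟨hcard, hx⟩ := h
  obtain ⟨e, he⟩ := Finset.card_eq_one.1 hcard
  have hea : e ∈ a \ p := he ▸ Finset.mem_singleton_self e
  rw [Finset.mem_sdiff] at hea
  have hγ : ∀ γ ∈ (p ∩ a).ssubsets, γ ⊂ p ∩ a := fun γ hγ => Finset.mem_ssubsets.1 hγ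
  have hγp : ∀ γ ∈ (p ∩ a).ssubsets, γ ∪ p \ a ⊂ p := by
    intro γ h
    obtain ⟨h1, h2⟩ := Finset.ssubset_iff_subset_ne.1 (hγ γ h)
    refine Finset.ssubset_iff_subset_ne.2 ⟨Finset.union_subset
      (h1.trans Finset.inter_subset_left) Finset.sdiff_subset, fun h3 => h2 ?_⟩
    refine h1.antisymm fun i hi => ?_
    rw [Finset.mem_inter] at hi
    have := h3.symm ▸ hi.1
    simpa [hi.2] using this
  have hγa : ∀ γ ∈ (p ∩ a).ssubsets, γ ∪ a \ p ⊂ a := by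
    intro γ h
    obtain ⟨h1, h2⟩ := Finset.ssubset_iff_subset_ne.1 (hγ γ h)
    refine Finset.ssubset_iff_subset_ne.2 ⟨Finset.union_subset
      (h1.trans Finset.inter_subset_right) Finset.sdiff_subset, fun h3 => h2 ?_⟩
    refine h1.antisymm fun i hi => ?_
    rw [Finset.mem_inter] at hi
    have := h3.symm ▸ hi.2
    simpa [hi.1] using this
  have hinjp : Set.InjOn (fun γ => γ ∪ p \ a) ((p ∩ a).ssubsets : Set (Finset ℕ)) := by
    have hrec : ∀ γ ∈ (p ∩ a).ssubsets, (γ ∪ p \ a) ∩ a = γ := by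
      intro γ h
      have h1 := (hγ γ h).1.trans Finset.inter_subset_right
      rw [Finset.union_inter_distrib_right, Finset.inter_eq_left.2 h1]
      simp
    intro γ h γ' h' heq
    rw [← hrec γ h, ← hrec γ' h']
    exact congrArg (· ∩ a) heq
  have hinja : Set.InjOn (fun γ => γ ∪ a \ p) ((p ∩ a).ssubsets : Set (Finset ℕ)) := by
    have hrec : ∀ γ ∈ (p ∩ a).ssubsets, (γ ∪ a \ p) ∩ p = γ := by
      intro γ h
      have h1 := (hγ γ h).1.trans Finset.inter_subset_left
      rw [Finset.union_inter_distrib_right, Finset.inter_eq_left.2 h1]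
      simp
    intro γ h γ' h' heq
    rw [← hrec γ h, ← hrec γ' h']
    exact congrArg (· ∩ p) heq
  set G := (p ∩ a).ssubsets.image (fun γ => γ ∪ p \ a) ∪
    (p ∩ a).ssubsets.image (fun γ => γ ∪ a \ p) with hG
  have hdisj : Disjoint ((p ∩ a).ssubsets.image (fun γ => γ ∪ p \ a))
      ((p ∩ a).ssubsets.image (fun γ => γ ∪ a \ p)) := by
    rw [Finset.disjoint_left]
    intro b hb hb'
    obtain ⟨γ, h, rfl⟩ := Finset.mem_image.1 hb
    obtain ⟨γ', -, h2⟩ := Finset.mem_image.1 hb'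
    have h3 : e ∈ γ' ∪ a \ p := Finset.mem_union_right _ (Finset.mem_sdiff.2 hea)
    rw [h2] at h3
    exact hea.2 ((hγp γ h).1 h3)
  have hsumG : ∑ b ∈ G, x b = ∑ γ ∈ (p ∩ a).ssubsets, (x (γ ∪ p \ a) + x (γ ∪ a \ p)) := by
    rw [hG, Finset.sum_union hdisj, Finset.sum_image hinjp, Finset.sum_image hinja,
      Finset.sum_add_distrib]
  have hsplit : ∑ γ ∈ (p ∩ a).powerset, (x (γ ∪ p \ a) + x (γ ∪ a \ p)) =
      (x p + x a) + ∑ b ∈ G, x b := by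
    rw [hsumG, Finset.ssubsets, ← Finset.add_sum_erase _ _ (Finset.mem_powerset_self (p ∩ a))]
    congr 3
    · rw [Finset.union_comm, Finset.sdiff_union_inter]
    · rw [Finset.union_comm, Finset.inter_comm, Finset.sdiff_union_inter]
  refine ⟨G ∩ S, Finset.inter_subset_right, ?_⟩
  have hW : ∑ b ∈ G ∩ S, x b = ∑ b ∈ G, x b := by
    refine Finset.sum_subset Finset.inter_subset_left fun b hb hb' => ?_
    have hbS : b ∉ S := fun h => hb' (Finset.mem_inter.2 ⟨hb, h⟩)
    rcases Finset.mem_union.1 hb with h | h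
    · obtain ⟨γ, hm, rfl⟩ := Finset.mem_image.1 h
      exact (hS _ (hγp γ hm).ne (Or.inl (hγp γ hm))).resolve_right hbS
    · obtain ⟨γ, hm, rfl⟩ := Finset.mem_image.1 h
      refine (hS _ (fun h' => hea.2 ?_) (Or.inr (hγa γ hm))).resolve_right hbS
      rw [← h']
      exact Finset.mem_union_right _ (Finset.mem_sdiff.2 hea)
  rw [hW]
  linarith

/-- No set in the list contains a later one, so a proper subset of p or a, other than p, is either
earlier in the list, hence in `S`, or off the list, where x vanishes. -/
theorem exists_eq_sub_sum_of_linked {m : ℕ} {x : Finset ℕ → ℝ} {S l : List (Finset ℕ)}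
    {p a : Finset ℕ} (hpw : (S ++ p :: a :: l).Pairwise fun b c => ¬ c ⊆ b)
    (hsub : ∀ b ∈ S ++ p :: a :: l, b ⊆ Finset.range m)
    (hzero : ∀ b ⊆ Finset.range m, b ∉ S ++ p :: a :: l → x b = 0) (h : Linked x p a) :
    ∃ W ⊆ S.toFinset, x a = (2 ^ (a.card - 1) - 1) * x p - ∑ b ∈ W, x b := by
  rw [← h.card_inter]
  refine h.exists_eq_sub_sum fun b hbp hb => ?_
  rw [List.mem_toFinset]
  by_cases hbT : b ∈ S ++ p :: a :: l
  · refine Or.inr ?_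
    have h1 := (List.pairwise_append.1 hpw).2.1
    rw [List.pairwise_cons, List.pairwise_cons] at h1
    simp only [List.mem_append, List.mem_cons] at hbT
    rcases hbT with hbT | rfl | rfl | hbT
    · exact hbT
    · exact absurd rfl hbp
    · rcases hb with hb | hb
      · exact absurd hb.1 (h1.1 _ List.mem_cons_self)
      · exact absurd rfl hb.ne
    · rcases hb with hb | hb
      · exact absurd hb.1 (h1.1 _ (List.mem_cons_of_mem _ hbT))
      · exact absurd hb.1 (h1.2.1 _ hbT)
  · refine Or.inl (hzero b ?_ hbT)
    rcases hb with hb | hb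
    · exact hb.1.trans (hsub p (by simp))
    · exact hb.1.trans (hsub a (by simp))

/-- The recursion propagates zeros along the list; this yields the injectivity of the Alon–Vu
matrix. -/
theorem eq_zero_of_isChain_linked {m : ℕ} {x : Finset ℕ → ℝ} {l S : List (Finset ℕ)}
    {p : Finset ℕ} (hpw : (S ++ p :: l).Pairwise fun b c => ¬ c ⊆ b)
    (hsub : ∀ b ∈ S ++ p :: l, b ⊆ Finset.range m)
    (hzero : ∀ b ⊆ Finset.range m, b ∉ S ++ p :: l → x b = 0)
    (hchain : (p :: l).IsChain (Linked x)) (hS : ∀ b ∈ S, x b = 0) (hp : x p = 0) :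
    ∀ b ⊆ Finset.range m, x b = 0 := by
  induction l generalizing S p with
  | nil =>
    intro b hb
    by_cases h : b ∈ S ++ [p]
    · rcases List.mem_append.1 h with h | h
      · exact hS b h
      · rwa [List.mem_singleton.1 h]
    · exact hzero b hb h
  | cons a l ih =>
    rw [List.isChain_cons_cons] at hchain
    obtain ⟨W, hW, hxa⟩ := exists_eq_sub_sum_of_linked hpw hsub hzero hchain.1
    have h0 : ∑ b ∈ W, x b = 0 :=
      Finset.sum_eq_zero fun b hb => hS b (List.mem_toFinset.1 (hW hb))
    have happ : S ++ p :: a :: l = (S ++ [p]) ++ a :: l := by simp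
    rw [happ] at hpw hsub hzero
    refine ih hpw hsub hzero hchain.2 (fun b hb => ?_) ?_
    · rcases List.mem_append.1 hb with h | h
      · exact hS b h
      · rwa [List.mem_singleton.1 h]
    · rw [hxa, hp, h0]
      ring

/-- The invariant is that x p dominates the sum of the earlier, nonnegative coordinates. The
subtracted sum then costs at most x p, so x a ≥ (2^(|a|-1) - 2) x p. Since |a| ≥ 3 this factor is at
least 2, so x a ≥ 2 x p dominates the enlarged sum. -/
theorem prod_mul_le_of_isChain_linked {m : ℕ} {x : Finset ℕ → ℝ} {l S : List (Finset ℕ)}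
    {p : Finset ℕ} (hpw : (S ++ p :: l).Pairwise fun b c => ¬ c ⊆ b)
    (hsub : ∀ b ∈ S ++ p :: l, b ⊆ Finset.range m)
    (hzero : ∀ b ⊆ Finset.range m, b ∉ S ++ p :: l → x b = 0)
    (hchain : (p :: l).IsChain (Linked x)) (hcard : ∀ a ∈ l, 3 ≤ a.card)
    (hS : ∀ b ∈ S, 0 ≤ x b) (hp : ∑ b ∈ S.toFinset, x b ≤ x p) :
    ∃ b ⊆ Finset.range m, x p * (l.map fun a => (2 : ℝ) ^ (a.card - 1) - 2).prod ≤ x b := by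
  have hS' : ∀ b ∈ S.toFinset, 0 ≤ x b := fun b hb => hS b (List.mem_toFinset.1 hb)
  have hp0 : 0 ≤ x p := (Finset.sum_nonneg hS').trans hp
  induction l generalizing S p with
  | nil => exact ⟨p, hsub p (by simp), by simp⟩
  | cons a l ih =>
    rw [List.isChain_cons_cons] at hchain
    obtain ⟨W, hW, hxa⟩ := exists_eq_sub_sum_of_linked hpw hsub hzero hchain.1
    have hsum : ∑ b ∈ W, x b ≤ x p :=
      (Finset.sum_le_sum_of_subset_of_nonneg hW fun b hb _ => hS' b hb).trans hp
    have hpow : (4 : ℝ) ≤ 2 ^ (a.card - 1) := by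
      have h3 := hcard a List.mem_cons_self
      calc (4 : ℝ) = 2 ^ 2 := by norm_num
        _ ≤ 2 ^ (a.card - 1) := pow_le_pow_right₀ (by norm_num) (by omega)
    have hge : x p * (2 ^ (a.card - 1) - 2) ≤ x a := by
      rw [hxa]
      linarith
    have hpS : p ∉ S.toFinset := by
      rw [List.mem_toFinset]
      intro h
      exact (List.pairwise_append.1 hpw).2.2 p h p (by simp) subset_rfl
    have happ : S ++ p :: a :: l = (S ++ [p]) ++ a :: l := by simp
    rw [happ] at hpw hsub hzero
    have hnn : ∀ b ∈ S ++ [p], 0 ≤ x b := fun b hb => by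
      rcases List.mem_append.1 hb with h | h
      · exact hS b h
      · rwa [List.mem_singleton.1 h]
    have hsum' : ∑ b ∈ (S ++ [p]).toFinset, x b ≤ x a := by
      have h1 : (S ++ [p]).toFinset = insert p S.toFinset := by
        ext b
        simp
      rw [h1, Finset.sum_insert hpS]
      nlinarith
    have hxa0 : 0 ≤ x a := by nlinarith
    obtain ⟨b, hb, hle⟩ := ih hpw hsub hzero hchain.2
      (fun c hc => hcard c (List.mem_cons_of_mem _ hc)) hnn hsum'
      (fun b hb => hnn b (List.mem_toFinset.1 hb)) hxa0
    refine ⟨b, hb, le_trans ?_ hle⟩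
    rw [List.map_cons, List.prod_cons, ← mul_assoc]
    refine mul_le_mul_of_nonneg_right hge (List.prod_nonneg fun t ht => ?_)
    obtain ⟨c, hc, rfl⟩ := List.mem_map.1 ht
    have h3 := hcard c (List.mem_cons_of_mem _ hc)
    have : (2 : ℝ) ^ 1 ≤ 2 ^ (c.card - 1) := pow_le_pow_right₀ (by norm_num) (by omega)
    linarith

theorem linked_of_sum_stepRow_mul_eq_zero {U : Finset (Finset ℕ)} {y : Finset ℕ → ℝ}
    {p a : Finset ℕ} (hcard : (a \ p).card = 1) (h : ∑ β ∈ U, stepRow p a β * y β = 0) :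
    Linked (fun γ => ∑ β ∈ U, walsh γ β * y β) p a := by
  refine ⟨hcard, ?_⟩
  have h1 : ∑ β ∈ U, 2 ^ (p ∩ a).card * stepRow p a β * y β = 0 := by
    simp only [mul_assoc]
    rw [← Finset.mul_sum, h, mul_zero]
  simp only [two_pow_mul_stepRow, sub_mul, Finset.sum_sub_distrib, Finset.sum_mul] at h1
  rw [sub_eq_zero, Finset.sum_comm] at h1
  simp only [add_mul, Finset.sum_add_distrib, mul_assoc, ← Finset.mul_sum] at h1 ⊢
  exact h1

/-! ### The Alon–Vu matrix -/

/-- The index type of the Alon–Vu matrix: the nonempty subsets of `{0, …, m - 1}`. -/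
abbrev NonemptySubset (m : ℕ) : Type := ((Finset.range m).powerset.erase ∅ : Finset (Finset ℕ))

theorem card_nonemptySubset (m : ℕ) : Fintype.card (NonemptySubset m) = 2 ^ m - 1 := by
  rw [Fintype.card_coe, Finset.card_erase_of_mem (Finset.empty_mem_powerset _),
    Finset.card_powerset, Finset.card_range]

/-- The `0/1` form of the Alon–Vu matrix. -/
noncomputable def alonVuMatrix (m : ℕ) (l : List (Finset ℕ)) :
    Matrix (NonemptySubset m) (NonemptySubset m) ℝ :=
  Matrix.of fun α β => (1 - listRow l α β) / 2

theorem alonVuMatrix_eq_or (m : ℕ) (l : List (Finset ℕ)) (α β : NonemptySubset m) :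
    alonVuMatrix m l α β = 0 ∨ alonVuMatrix m l α β = 1 := by
  have h : ∀ β, listRow l α β = 1 ∨ listRow l α β = -1 :=
    listRow_induction (P := fun f => ∀ β, f β = 1 ∨ f β = -1) stepRow_eq_or walsh_eq_or l α
  rcases h β with h | h <;> simp [alonVuMatrix, h]

/-- Extension of a vector by a coordinate at `∅` such that all coordinates sum to zero. -/
noncomputable def balance {m : ℕ} (z : NonemptySubset m → ℝ) (β : Finset ℕ) : ℝ :=
  if h : β ∈ (Finset.range m).powerset.erase ∅ then z ⟨β, h⟩ else -∑ i, z i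

theorem balance_coe {m : ℕ} (z : NonemptySubset m → ℝ) (i : NonemptySubset m) :
    balance z i = z i := by
  simp only [balance, i.2, dif_pos]

theorem sum_mul_balance {m : ℕ} (z : NonemptySubset m → ℝ) (f : Finset ℕ → ℝ) :
    ∑ β ∈ (Finset.range m).powerset, f β * balance z β = ∑ i : NonemptySubset m, (f i - f ∅) * z i := by
  rw [← Finset.add_sum_erase _ _ (Finset.empty_mem_powerset (Finset.range m)),
    ← Finset.sum_coe_sort ((Finset.range m).powerset.erase ∅)]
  have h0 : balance z ∅ = -∑ i, z i := by simp [balance]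
  simp only [balance_coe, h0, sub_mul, Finset.sum_sub_distrib, ← Finset.mul_sum]
  ring

/-- The character sums of a balanced vector. -/
noncomputable def transform {m : ℕ} (z : NonemptySubset m → ℝ) (γ : Finset ℕ) : ℝ :=
  ∑ β ∈ (Finset.range m).powerset, walsh γ β * balance z β

/-- Every row is 1 at ∅, so balancing the vector accounts for the deleted column and turns the ±1
row into the 0/1 row (1 - row)/2, scaled by -2. -/
theorem sum_listRow_mul_balance {m : ℕ} (l : List (Finset ℕ)) (z : NonemptySubset m → ℝ)
    (α : NonemptySubset m) :
    ∑ β ∈ (Finset.range m).powerset, listRow l α β * balance z β =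
      -2 * (alonVuMatrix m l).mulVec z α := by
  have h : listRow l α ∅ = 1 :=
    listRow_induction (P := fun f => f ∅ = 1) stepRow_empty walsh_empty_right l α
  rw [sum_mul_balance, h, Matrix.mulVec, dotProduct, Finset.mul_sum]
  refine Finset.sum_congr rfl fun i _ => ?_
  simp only [alonVuMatrix, Matrix.of_apply]
  ring

theorem transform_empty {m : ℕ} (z : NonemptySubset m → ℝ) : transform z ∅ = 0 := by
  simp only [transform, walsh_empty_left]
  simpa using sum_mul_balance z fun _ => 1

theorem abs_transform_le {m : ℕ} (z : NonemptySubset m → ℝ) (γ : Finset ℕ) :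
    |transform z γ| ≤ ∑ i, 2 * |z i| := by
  rw [transform, sum_mul_balance]
  refine (Finset.abs_sum_le_sum_abs _ _).trans (Finset.sum_le_sum fun i _ => ?_)
  rw [abs_mul, walsh_empty_right]
  refine mul_le_mul_of_nonneg_right ?_ (abs_nonneg _)
  rcases walsh_eq_or γ i with h | h <;> rw [h] <;> norm_num

theorem transform_eq_of_notMem {m : ℕ} {p : Finset ℕ} {l : List (Finset ℕ)}
    {z : NonemptySubset m → ℝ} {t : ℝ} (hp : p ∈ (Finset.range m).powerset.erase ∅)
    (hz : (alonVuMatrix m (p :: l)).mulVec z = Pi.single ⟨p, hp⟩ t) {b : Finset ℕ}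
    (hb : b ⊆ Finset.range m) (hbl : b ∉ l) :
    transform z b = if b = p then -2 * t else 0 := by
  rcases eq_or_ne b ∅ with rfl | hb0
  · rw [transform_empty, if_neg]
    rintro rfl
    simp at hp
  · have hb' : b ∈ (Finset.range m).powerset.erase ∅ :=
      Finset.mem_erase.2 ⟨hb0, Finset.mem_powerset.2 hb⟩
    have h := sum_listRow_mul_balance (p :: l) z ⟨b, hb'⟩
    rw [listRow_of_notMem hbl, hz, Pi.single_apply] at h
    rw [transform, h]
    simp [Subtype.ext_iff]

theorem isChain_linked_transform {m : ℕ} {p : Finset ℕ} {l : List (Finset ℕ)}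
    (hl : binaryList m 3 = p :: l)
    {z : NonemptySubset m → ℝ} {t : ℝ} (hp : p ∈ (Finset.range m).powerset.erase ∅)
    (hz : (alonVuMatrix m (p :: l)).mulVec z = Pi.single ⟨p, hp⟩ t) :
    (p :: l).IsChain (Linked (transform z)) := by
  have hnd : (p :: l).Nodup := hl ▸ nodup_binaryList m 3
  have h1 := isChain_binaryList m 3
  rw [hl] at h1
  have h2 : (p :: l).IsChain fun p a =>
      ∑ β ∈ (Finset.range m).powerset, stepRow p a β * balance z β = 0 := by
    refine isChain_of_forall_listRow
      (P := fun f => ∑ β ∈ (Finset.range m).powerset, f β * balance z β = 0) hnd fun α hα => ?_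
    have hα' : α ∈ binaryList m 3 := hl ▸ List.mem_cons_of_mem _ hα
    obtain ⟨h3, h4⟩ := mem_binaryList.1 hα'
    have hα0 : α ∈ (Finset.range m).powerset.erase ∅ := by
      refine Finset.mem_erase.2 ⟨?_, Finset.mem_powerset.2 h3⟩
      rintro rfl
      simp at h4
    have h := sum_listRow_mul_balance (p :: l) z ⟨α, hα0⟩
    rw [hz, Pi.single_apply, if_neg, mul_zero] at h
    · exact h
    · rw [Subtype.ext_iff]
      rintro rfl
      exact (List.nodup_cons.1 hnd).1 hα
  rw [List.isChain_iff_getElem] at h1 h2 ⊢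
  exact fun i hi => linked_of_sum_stepRow_mul_eq_zero (h1 i hi).2.2 (h2 i hi)

/-- The inverse entries of the Alon–Vu matrix are huge. -/
theorem prod_le_two_pow_mul_chi {m : ℕ} {p : Finset ℕ} {l : List (Finset ℕ)}
    (hl : binaryList m 3 = p :: l) :
    (l.map fun a => (2 : ℝ) ^ (a.card - 1) - 2).prod ≤ 2 ^ m * chi (2 ^ m - 1) := by
  have hpm : p ∈ binaryList m 3 := hl ▸ List.mem_cons_self
  obtain ⟨hpsub, hpcard⟩ := mem_binaryList.1 hpm
  have hp : p ∈ (Finset.range m).powerset.erase ∅ := by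
    refine Finset.mem_erase.2 ⟨?_, Finset.mem_powerset.2 hpsub⟩
    rintro rfl
    simp at hpcard
  have hpw : ([] ++ p :: l).Pairwise fun b c : Finset ℕ => ¬ c ⊆ b := by
    rw [List.nil_append, ← hl]
    exact pairwise_binaryList m 3
  have hsub : ∀ b ∈ [] ++ p :: l, b ⊆ Finset.range m := fun b hb => by
    rw [List.nil_append, ← hl] at hb
    exact (mem_binaryList.1 hb).1
  have hzero : ∀ (z : NonemptySubset m → ℝ) (t : ℝ),
      (alonVuMatrix m (p :: l)).mulVec z = Pi.single ⟨p, hp⟩ t →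
      ∀ b ⊆ Finset.range m, b ∉ [] ++ p :: l → transform z b = 0 := by
    intro z t hz b hb hbl
    rw [List.nil_append, List.mem_cons, not_or] at hbl
    rw [transform_eq_of_notMem hp hz hb hbl.2, if_neg hbl.1]
  have hpl : p ∉ l := (List.nodup_cons.1 (hl ▸ nodup_binaryList m 3)).1
  have hinj : Function.Injective (alonVuMatrix m (p :: l)).mulVec := by
    have h : ∀ z, (alonVuMatrix m (p :: l)).mulVecLin z = 0 → z = 0 := by
      intro z hz
      have hz' : (alonVuMatrix m (p :: l)).mulVec z = Pi.single ⟨p, hp⟩ 0 := by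
        rw [Pi.single_zero]
        exact hz
      have h1 := eq_zero_of_isChain_linked hpw hsub (hzero z 0 hz')
        (isChain_linked_transform hl hp hz') (by simp)
        (by rw [transform_eq_of_notMem hp hz' hpsub hpl]; simp)
      have h2 := eq_zero_of_forall_sum_walsh_eq_zero (U := Finset.range m) (y := balance z)
        fun γ hγ => h1 γ (Finset.mem_powerset.1 hγ)
      ext i
      rw [← balance_coe z]
      exact h2 i (Finset.mem_of_mem_erase i.2)
    exact (injective_iff_map_eq_zero (alonVuMatrix m (p :: l)).mulVecLin).2 h
  -- The value -1/2 normalizes the first coordinate of the recursion to 1, because of the factor -2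
  -- between character sums and the 0/1 matrix.
  obtain ⟨z, hz⟩ := (Matrix.mulVec_surjective_iff_isUnit.2
    (Matrix.mulVec_injective_iff_isUnit.1 hinj)) (Pi.single ⟨p, hp⟩ (-1 / 2))
  have hxp : transform z p = 1 := by
    rw [transform_eq_of_notMem hp hz hpsub hpl]
    norm_num
  obtain ⟨b, -, hb⟩ := prod_mul_le_of_isChain_linked hpw hsub (hzero z _ hz)
    (isChain_linked_transform hl hp hz)
    (fun a ha => (mem_binaryList.1 (hl ▸ List.mem_cons_of_mem _ ha : a ∈ binaryList m 3)).2)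
    (by simp) (by simp [hxp])
  rw [hxp, one_mul] at hb
  refine hb.trans ((le_abs_self _).trans ((abs_transform_le z b).trans ?_))
  have hle := abs_le_mul_chi_of_mulVec_eq (card_nonemptySubset m) _
    (alonVuMatrix_eq_or m (p :: l)) hinj z _ _ hz
  have hchi : 0 ≤ chi (2 ^ m - 1) := by
    refine zero_le_one.trans (one_le_chi ?_)
    rw [← card_nonemptySubset m]
    exact Fintype.card_pos_iff.2 ⟨⟨p, hp⟩⟩
  calc ∑ i, 2 * |z i| ≤ ∑ _i : NonemptySubset m, chi (2 ^ m - 1) := by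
        refine Finset.sum_le_sum fun i _ => ?_
        have := hle i
        norm_num [abs_div] at this
        linarith
    _ = ((2 ^ m - 1 : ℕ) : ℝ) * chi (2 ^ m - 1) := by
        rw [Finset.sum_const, Finset.card_univ, card_nonemptySubset, nsmul_eq_mul]
    _ ≤ 2 ^ m * chi (2 ^ m - 1) := by
        refine mul_le_mul_of_nonneg_right ?_ hchi
        exact_mod_cast Nat.sub_le _ _

/-! ### The size of the entries for powers of two -/

/-- With u = 2/2^c the claim reads (1/2)^(2u) ≤ 1 - u, Bernoulli's inequality for an exponent 2u in
[0, 1]. -/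
theorem rpow_le_two_pow_sub_two {c : ℕ} (hc : 2 ≤ c) :
    (2 : ℝ) ^ ((c : ℝ) - 4 * (1 / 2) ^ c) ≤ 2 ^ c - 2 := by
  set u : ℝ := 2 * (1 / 2) ^ c with hu
  have hu0 : 0 ≤ u := by positivity
  have hu1 : u ≤ 1 / 2 := by
    have : ((1 : ℝ) / 2) ^ c ≤ (1 / 2) ^ 2 :=
      pow_le_pow_of_le_one (by norm_num) (by norm_num) hc
    rw [hu]
    linarith
  have h := rpow_one_add_le_one_add_mul_self (s := -1 / 2) (p := 2 * u) (by norm_num)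
    (by linarith) (by linarith)
  have h1 : (2 : ℝ) ^ ((c : ℝ) - 4 * (1 / 2) ^ c) = 2 ^ c * (1 + -1 / 2) ^ (2 * u) := by
    have h2 : (1 + -1 / 2 : ℝ) = 2⁻¹ := by norm_num
    rw [h2, Real.inv_rpow (by norm_num), Real.rpow_sub (by norm_num), Real.rpow_natCast,
      div_eq_mul_inv]
    congr 3
    rw [hu]
    ring
  have h3 : (2 : ℝ) ^ c * u = 2 := by
    rw [hu, mul_left_comm, ← mul_pow]
    norm_num
  rw [h1]
  calc (2 : ℝ) ^ c * (1 + -1 / 2) ^ (2 * u) ≤ 2 ^ c * (1 + 2 * u * (-1 / 2)) :=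
        mul_le_mul_of_nonneg_left h (by positivity)
    _ = 2 ^ c - 2 := by linear_combination -h3

/-- A lower bound for the binary logarithm of the growth contributed by a set `a`. -/
noncomputable def weight (a : Finset ℕ) : ℝ := (a.card : ℝ) - 1 - 8 * (1 / 2) ^ a.card

theorem rpow_weight_le {a : Finset ℕ} (ha : 3 ≤ a.card) :
    (2 : ℝ) ^ weight a ≤ 2 ^ (a.card - 1) - 2 := by
  obtain ⟨c, hc⟩ : ∃ c, a.card = c + 1 := ⟨a.card - 1, by omega⟩
  have h := rpow_le_two_pow_sub_two (c := c) (by omega)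
  rw [weight, hc, Nat.add_sub_cancel]
  convert h using 2
  rw [pow_succ]
  push_cast
  ring

theorem weight_nonpos {a : Finset ℕ} (ha : a.card < 3) : weight a ≤ 0 := by
  unfold weight
  interval_cases a.card <;> norm_num

theorem sum_card_powerset_range (m : ℕ) :
    ∑ a ∈ (Finset.range m).powerset, (a.card : ℝ) = m * 2 ^ m / 2 := by
  induction m with
  | zero => simp
  | succ m ih =>
    rw [Finset.range_add_one, Finset.sum_powerset_insert Finset.notMem_range_self, ih,
      Finset.sum_congr rfl (g := fun a => (a.card : ℝ) + 1) (s₁ := (Finset.range m).powerset)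
        (f := fun a => ((insert m a).card : ℝ))]
    · rw [Finset.sum_add_distrib, ih]
      simp
      ring
    · intro a ha
      rw [Finset.card_insert_of_notMem fun h => by simpa using Finset.mem_powerset.1 ha h]
      push_cast
      rfl

theorem sum_weight (m : ℕ) :
    ∑ a ∈ (Finset.range m).powerset, weight a = m * 2 ^ m / 2 - 2 ^ m - 8 * (3 / 2) ^ m := by
  have h : ∑ a ∈ (Finset.range m).powerset, ((1 : ℝ) / 2) ^ a.card = (3 / 2) ^ m := by
    have h1 := Finset.sum_pow_mul_eq_add_pow (1 / 2 : ℝ) 1 (Finset.range m)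
    simp only [one_pow, mul_one, Finset.card_range] at h1
    rw [h1]
    norm_num
  simp only [weight, Finset.sum_sub_distrib, ← Finset.mul_sum, h, sum_card_powerset_range]
  simp

/-- The error term for a block of size `2 ^ m`. -/
noncomputable def blockError (m : ℕ) : ℝ := 8 * (3 / 2) ^ m + 2 * m

theorem le_logb_chi_two_pow (m : ℕ) :
    (m : ℝ) * 2 ^ m / 2 - 2 ^ m - blockError m ≤ Real.logb 2 (chi (2 ^ m)) := by
  obtain hm | hm := lt_or_ge m 3
  · refine le_trans ?_ (Real.logb_nonneg one_lt_two (one_le_chi (by positivity)))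
    unfold blockError
    interval_cases m <;> norm_num
  obtain ⟨p, l, hl⟩ : ∃ p l, binaryList m 3 = p :: l := by
    refine List.exists_cons_of_ne_nil fun h => ?_
    have := head?_binaryList hm
    rw [h] at this
    simp at this
  have hnd : (p :: l).Nodup := hl ▸ nodup_binaryList m 3
  have hmem : ∀ a, a ∈ p :: l ↔ a ⊆ Finset.range m ∧ 3 ≤ a.card := fun a => by
    rw [← hl, mem_binaryList]
  have hprod : (2 : ℝ) ^ (∑ a ∈ l.toFinset, weight a) ≤
      (l.map fun a => (2 : ℝ) ^ (a.card - 1) - 2).prod := by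
    rw [← List.prod_toFinset _ (List.nodup_cons.1 hnd).2, Real.rpow_sum_of_pos two_pos]
    refine Finset.prod_le_prod (fun _ _ => by positivity) fun a ha => rpow_weight_le ?_
    exact ((hmem a).1 (List.mem_cons_of_mem _ (List.mem_toFinset.1 ha))).2
  -- Sets with fewer than 3 elements have nonpositive weight, so the sum may run over all subsets.
  -- The first set `p` contributes no factor and costs at most m; the factor 2^m in front of χ costs
  -- another m, whence 2m in `blockError`.
  have hsum : ∑ a ∈ (Finset.range m).powerset, weight a ≤ m + ∑ a ∈ l.toFinset, weight a := by
    have h1 : ∑ a ∈ (Finset.range m).powerset, weight a ≤ ∑ a ∈ (p :: l).toFinset, weight a := by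
      have hsub : (p :: l).toFinset ⊆ (Finset.range m).powerset := fun a ha =>
        Finset.mem_powerset.2 ((hmem a).1 (List.mem_toFinset.1 ha)).1
      rw [← Finset.sum_sdiff hsub]
      refine add_le_of_nonpos_left (Finset.sum_nonpos fun a ha => weight_nonpos ?_)
      rw [Finset.mem_sdiff, List.mem_toFinset, hmem, Finset.mem_powerset] at ha
      by_contra h
      exact ha.2 ⟨ha.1, by omega⟩
    refine h1.trans ?_
    rw [List.toFinset_cons, Finset.sum_insert
      (by rw [List.mem_toFinset]; exact (List.nodup_cons.1 hnd).1)]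
    have h2 : (p.card : ℝ) ≤ m := by
      have := Finset.card_le_card ((hmem p).1 List.mem_cons_self).1
      rw [Finset.card_range] at this
      exact_mod_cast this
    have h3 : (0 : ℝ) ≤ 8 * (1 / 2) ^ p.card := by positivity
    unfold weight
    linarith
  have hpos : 0 < 2 ^ m - 1 := by
    have := Nat.one_lt_two_pow (n := m) (by omega)
    omega
  have hle : (2 : ℝ) ^ (∑ a ∈ l.toFinset, weight a) ≤ 2 ^ m * chi (2 ^ m) :=
    (hprod.trans (prod_le_two_pow_mul_chi hl)).trans
      (mul_le_mul_of_nonneg_left (chi_mono hpos (Nat.sub_le _ _)) (by positivity))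
  have hchi : 0 < chi (2 ^ m) := one_pos.trans_le (one_le_chi (by positivity))
  have hlog := (Real.le_logb_iff_rpow_le one_lt_two (by positivity)).2 hle
  rw [Real.logb_mul (by positivity) hchi.ne', Real.logb_pow, Real.logb_self_eq_one one_lt_two,
    mul_one] at hlog
  rw [sum_weight] at hsum
  unfold blockError
  linarith

/-! ### The size of the entries in general -/

theorem logb_chi_add_le (a b : ℕ) :
    Real.logb 2 (chi a) + Real.logb 2 (chi b) ≤ Real.logb 2 (chi (a + b)) := by
  rcases Nat.eq_zero_or_pos a with rfl | ha
  · simp [chi_zero]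
  rcases Nat.eq_zero_or_pos b with rfl | hb
  · simp [chi_zero]
  have h1 := one_pos.trans_le (one_le_chi ha)
  have h2 := one_pos.trans_le (one_le_chi hb)
  rw [← Real.logb_mul h1.ne' h2.ne']
  exact Real.logb_le_logb_of_le one_lt_two (by positivity) (chi_mul_chi_le ha hb)

/-- Midpoint convexity of t log t: splitting x + y into two parts loses at most one bit per unit. -/
theorem add_mul_logb_add_le {x y : ℝ} (hx : 0 < x) (hy : 0 ≤ y) :
    (x + y) * Real.logb 2 (x + y) ≤
      x * Real.logb 2 x + y * Real.logb 2 y + (x + y) := by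
  have h := Real.convexOn_mul_log.2 (Set.mem_Ici.2 hx.le) (Set.mem_Ici.2 hy)
    (by norm_num : (0 : ℝ) ≤ 1 / 2) (by norm_num : (0 : ℝ) ≤ 1 / 2) (by norm_num)
  simp only [smul_eq_mul] at h
  have h1 : (1 / 2 * x + 1 / 2 * y : ℝ) = (x + y) / 2 := by ring
  rw [h1, Real.log_div (by positivity) two_ne_zero] at h
  have hl : 0 < Real.log 2 := Real.log_pos one_lt_two
  unfold Real.logb
  have h2 : (x + y) * Real.log (x + y) ≤
      x * Real.log x + y * Real.log y + (x + y) * Real.log 2 := by linarith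
  calc (x + y) * (Real.log (x + y) / Real.log 2)
      = ((x + y) * Real.log (x + y)) / Real.log 2 := by ring
    _ ≤ (x * Real.log x + y * Real.log y + (x + y) * Real.log 2) / Real.log 2 :=
        div_le_div_of_nonneg_right h2 hl.le
    _ = _ := by field_simp

/-- Split off the leading binary digit, n = 2^m + r. Half the convexity loss is n/2 ≤ 2^m because r
≤ 2^m. Together with the loss 2^m of the block itself this makes 2 · 2^m, the share of the block in
2n. -/
theorem le_logb_chi (n : ℕ) :
    (n : ℝ) / 2 * Real.logb 2 n - 2 * n - ∑ j ∈ Finset.range n.size, blockError j ≤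
      Real.logb 2 (chi n) := by
  induction n using Nat.strong_induction_on with
  | _ n ih =>
    rcases Nat.eq_zero_or_pos n with rfl | hn
    · simp [chi_zero]
    obtain ⟨m, hm⟩ : ∃ m, n.size = m + 1 :=
      ⟨n.size - 1, by have := Nat.size_pos.2 hn; omega⟩
    have h1 : 2 ^ m ≤ n := Nat.lt_size.1 (by omega)
    have h2 : n < 2 ^ (m + 1) := Nat.size_le.1 hm.le
    obtain ⟨r, rfl⟩ := Nat.exists_eq_add_of_le h1
    have hr : r < 2 ^ m := by rw [pow_succ] at h2; omega
    have hr' : (r : ℝ) ≤ 2 ^ m := by exact_mod_cast hr.le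
    have hsize : r.size ≤ m := Nat.size_le.2 hr
    have hih := ih r (by omega)
    have hadd := logb_chi_add_le (2 ^ m) r
    have hblock := le_logb_chi_two_pow m
    have hconv := add_mul_logb_add_le (x := 2 ^ m) (y := r) (by positivity) (Nat.cast_nonneg r)
    have herr : ∑ j ∈ Finset.range r.size, blockError j ≤
        ∑ j ∈ Finset.range m, blockError j :=
      Finset.sum_le_sum_of_subset_of_nonneg (Finset.range_subset_range.2 hsize)
        fun j _ _ => by unfold blockError; positivity
    rw [Real.logb_pow, Real.logb_self_eq_one one_lt_two, mul_one] at hconv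
    rw [hm, Finset.sum_range_succ]
    push_cast
    linarith

/-- Each block error is o(2^m), so the sum over digit positions is o of the geometric sum 2^size -
1, which is at most 2d. -/
theorem isLittleO_sum_blockError :
    (fun d : ℕ => ∑ j ∈ Finset.range (d - 1).size, blockError j) =o[atTop]
      fun d : ℕ => (d : ℝ) := by
  have h1 : blockError =o[atTop] fun m : ℕ => (2 : ℝ) ^ m := by
    unfold blockError
    refine IsLittleO.add ?_ ?_
    · exact (isLittleO_pow_pow_of_lt_left (by norm_num) (by norm_num)).const_mul_left 8
    · exact (isLittleO_coe_const_pow_of_one_lt one_lt_two).const_mul_left 2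
  have hgeom : ∀ k, ∑ j ∈ Finset.range k, (2 : ℝ) ^ j = 2 ^ k - 1 := fun k => by
    rw [geom_sum_eq (by norm_num)]
    norm_num
  have h2 := h1.sum_range (fun _ => by positivity) (by
    simp only [hgeom]
    exact tendsto_atTop_add_const_right _ _ (tendsto_pow_atTop_atTop_of_one_lt one_lt_two))
  have htend : Tendsto (fun d : ℕ => (d - 1).size) atTop atTop := by
    refine tendsto_atTop.2 fun b => ?_
    filter_upwards [eventually_ge_atTop (2 ^ b + 1)] with d hd
    exact (Nat.lt_size.2 (by omega)).le
  refine (h2.comp_tendsto htend).trans_isBigO (IsBigO.of_bound 2 ?_)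
  filter_upwards with d
  simp only [Function.comp_apply, hgeom]
  have h0 : (1 : ℝ) ≤ 2 ^ (d - 1).size := one_le_pow₀ one_le_two
  rw [Real.norm_of_nonneg (by linarith), Real.norm_of_nonneg (Nat.cast_nonneg d)]
  have h3 : 2 ^ (d - 1).size ≤ 2 * d + 1 := by
    rcases Nat.eq_zero_or_pos (d - 1).size with h | h
    · rw [h]
      omega
    · have h4 : 2 ^ ((d - 1).size - 1) ≤ d - 1 := Nat.lt_size.1 (by omega)
      have h5 : 2 ^ (d - 1).size = 2 * 2 ^ ((d - 1).size - 1) := by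
        rw [← pow_succ']
        congr 1
        omega
      omega
  have h6 : (2 : ℝ) ^ (d - 1).size ≤ 2 * d + 1 := by exact_mod_cast h3
  linarith

theorem le_chi {d : ℕ} (hd : 2 ≤ d) :
    ((d : ℝ) - 1) ^ (((d : ℝ) - 1) / 2) /
        (2 : ℝ) ^ (2 * (d : ℝ) + ∑ j ∈ Finset.range (d - 1).size, blockError j) ≤
      chi (d - 1) := by
  obtain ⟨n, rfl⟩ : ∃ n, d = n + 1 := ⟨d - 1, by omega⟩
  have hn : 0 < n := by omega
  have hn' : (0 : ℝ) < n := by exact_mod_cast hn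
  have hchi := one_pos.trans_le (one_le_chi hn)
  have h := le_logb_chi n
  simp only [Nat.add_sub_cancel, Nat.cast_add, Nat.cast_one, add_sub_cancel_right]
  have h1 : (n : ℝ) ^ ((n : ℝ) / 2) = 2 ^ ((n : ℝ) / 2 * Real.logb 2 n) := by
    rw [mul_comm, Real.rpow_mul two_pos.le, Real.rpow_logb two_pos (by norm_num) hn']
  rw [h1, ← Real.rpow_sub two_pos, ← Real.le_logb_iff_rpow_le one_lt_two hchi]
  linarith

end ZeroOnePolytope

theorem mainTheorem4 :
    (∀ d : ℕ, 2 ≤ d →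
      IsGreatest (ZeroOnePolytope.invEntrySet (d - 1)) (ZeroOnePolytope.chi (d - 1)) ∧
      IsGreatest (ZeroOnePolytope.coeffSet d) (ZeroOnePolytope.coeff d) ∧
      IsGreatest (ZeroOnePolytope.detSet (d - 1)) (ZeroOnePolytope.rho (d - 1))) ∧
    ∃ ε : ℕ → ℝ, ε =o[atTop] (fun d : ℕ => (d : ℝ)) ∧
      ∀ d : ℕ, 2 ≤ d →
        ((d : ℝ) - 1) ^ (((d : ℝ) - 1) / 2) / (2 : ℝ) ^ (2 * (d : ℝ) + ε d)
            ≤ ZeroOnePolytope.chi (d - 1) ∧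
        ZeroOnePolytope.chi (d - 1) ≤ (ZeroOnePolytope.coeff d : ℝ) ∧
        (ZeroOnePolytope.coeff d : ℝ) ≤ ZeroOnePolytope.rho (d - 1) ∧
        ZeroOnePolytope.rho (d - 1) ≤ (d : ℝ) ^ ((d : ℝ) / 2) / (2 : ℝ) ^ ((d : ℝ) - 1) :=
  ⟨fun d hd => ⟨ZeroOnePolytope.isGreatest_chi (by omega), ZeroOnePolytope.isGreatest_coeff hd,
      ZeroOnePolytope.isGreatest_rho _⟩,
    _, ZeroOnePolytope.isLittleO_sum_blockError, fun _ hd =>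
      ⟨ZeroOnePolytope.le_chi hd, ZeroOnePolytope.chi_le_coeff hd,
        ZeroOnePolytope.coeff_le_rho hd, ZeroOnePolytope.rho_le hd⟩⟩
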